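/- Fix $n \ge 4$, put $v = n(n-3)/2$, and let $k, l : \mathbb R^2 \to \mathbb R$ be symmetric measurable kernels (for example $k=l=|x-y|$ or $k=l=|x-y|^2$). For all dimensions $p,q$ let $(X_1,Y_1),\dots,(X_n,Y_n)$ be i.i.d. copies of a random pair $(X,Y)$, $X=(x_1,\dots,x_p)\in\mathbb R^p$, $Y=(y_1,\dots,y_q)\in\mathbb R^q$, whose law may depend on $p,q$; write $x_{si}$, $y_{sj}$ for the coordinates of $X_s$, $Y_s$. For $s\ne t$ put $$k_{st}(i)=k(x_{si},x_{ti})-E[k(x_{si},x_{ti})\mid x_{si}]-E[k(x_{si},x_{ti})\mid x_{ti}]+E[k(x_{si},x_{ti})],$$ put $k_{ss}(i)=0$, and define $l_{st}(j)$ in the same way from $l$ and $y_{sj},y_{tj}$. Assume that $k(x_{si},x_{ti})$, $l(y_{sj},y_{tj})$ are integrable and $k_{st}(i)$, $l_{st}(j)$ square integrable for $s \neq t$ (for the kernels $|x-y|$ and $|x-y|^2$ this follows from D1 below). For an $n\times n$ matrix $A=(a_{st})$ let $\widetilde A$ be its $\mathcal U$-centered version: $\tilde a_{ss}=0$ and,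 for $s\neq t$, $$\tilde a_{st}=a_{st}-\tfrac1{n-2}\sum_{v'} a_{sv'}-\tfrac1{n-2}\sum_u a_{ut}+\tfrac1{(n-1)(n-2)}\sum_{u,v'}a_{uv'},$$ and let $(\widetilde A\cdot\widetilde B)=\frac1{n(n-3)}\sum_{s\ne t}\tilde a_{st}\tilde b_{st}$. With $\mathbf K(i)=(k_{st}(i))_{s,t}$ and $\mathbf L(j)=(l_{st}(j))_{s,t}$ define $$uCov_n^2(\mathbf X,\mathbf Y)=\frac1{\sqrt{pq}}\sum_{i=1}^p\sum_{j=1}^q(\widetilde{\mathbf K}(i)\cdot\widetilde{\mathbf L}(j)),$$ $uCov_n^2(\mathbf X,\mathbf X)$ (with $k$ twice) and $uCov_n^2(\mathbf Y,\mathbf Y)$ (with $l$ twice) likewise, and $$uCor_n^2=\frac{uCov_n^2(\mathbf X,\mathbf Y)}{\sqrt{uCov_n^2(\mathbf X,\mathbf X)\,uCov_n^2(\mathbf Y,\mathbf Y)}},\qquad T_u=\sqrt{v-1}\,\frac{uCor_n^2}{\sqrt{1-(uCor_n^2)^2}} .$$ Assume: (D1) there are constants $a,b,a',b'$, not depending on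 $p,q$, with $0<a\le \mathrm{var}(x_i)$, $E x_i^2\le b<\infty$, $0<a'\le \mathrm{var}(y_j)$ and $E y_j^2\le b'<\infty$ for all $i,j$ and all $p,q$; (D3) as $p\wedge q\to\infty$, the random vector $\big((p^{-1/2}\sum_{i} k_{st}(i))_{s<t},\,(q^{-1/2}\sum_{j} l_{st}(j))_{s<t}\big)$ converges in distribution to a jointly Gaussian vector $\big((c_{st})_{s<t},(d_{st})_{s<t}\big)$, and for all $s<t$ $$\mathrm{var}(c_{st})=\sigma_x^2=\lim\frac1p\sum_{i,j=1}^p\mathrm{cov}[k_{st}(i),k_{st}(j)],\qquad \mathrm{var}(d_{st})=\sigma_y^2=\lim\frac1q\sum_{i,j=1}^q\mathrm{cov}[l_{st}(i),l_{st}(j)],$$ $$\mathrm{cov}(c_{st},d_{st})=\sigma_{xy}^2=\lim\frac1{\sqrt{pq}}\sum_{i=1}^p\sum_{j=1}^q\mathrm{cov}[k_{st}(i),l_{st}(j)],$$ where $\sigma_x,\sigma_y>0$ and $\sigma_{xy}\in\mathbb R$ (so that $\sigma_{xy}^2\ge0$). Let $\phi=\sigma_{xy}^2/\sqrt{\sigma_x^2\sigma_y^2}$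 and suppose $\phi<1$. Then, as $p\wedge q\to\infty$, for every $t\in\mathbb R$: 1. if $X$ and $Y$ are independent (for all $p,q$), then $P(T_u\le t)\to P(t_{v-1}\le t)$; 2. in general, and in particular under the alternative that $X$ and $Y$ are dependent, $P(T_u\le t)\to E[P(t_{v-1,W}\le t)]$. Here $t_{v-1}$ is Student's $t$ distribution with $v-1$ degrees of freedom, $t_{v-1,w}$ is the noncentral $t$ distribution with $v-1$ degrees of freedom and noncentrality parameter $w$ (the law of $(Z+w)/\sqrt{V/(v-1)}$ with $Z\sim N(0,1)$ and $V\sim\chi^2_{v-1}$ independent), $\chi^2_v$ is the chi-square distribution with $v$ degrees of freedom, and $W\sim\sqrt{\frac{\phi^2}{1-\phi^2}\chi_v^2}$; the expectation is over $W$. -/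

import Mathlib

open MeasureTheory ProbabilityTheory Filter
open scoped Topology

noncomputable section

namespace HDIndep

/-! ### Reference distributions -/

/-- The chi-square distribution with `ν` degrees of freedom: the law of the sum of squares of
`ν` independent standard normal variables. -/
def chiSq (ν : ℕ) : Measure ℝ :=
  (Measure.pi (fun _ : Fin ν => gaussianReal 0 1)).map (fun z => ∑ i, z i ^ 2)

/-- Student's `t` distribution with `ν` degrees of freedom: the law of `Z / √(V / ν)` with
`Z` standard normal and `V` an independent chi-square variable with `ν` degrees of freedom. -/
def studentT (ν : ℕ) : Measure ℝ :=
  ((gaussianReal 0 1).prod (chiSq ν)).map (fun z => z.1 / √(z.2 / ν))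

/-- The noncentral `t` distribution with `ν` degrees of freedom and noncentrality parameter `w`:
the law of `(Z + w) / √(V / ν)` with `Z` standard normal and `V` an independent chi-square
variable with `ν` degrees of freedom. -/
def noncentralT (ν : ℕ) (w : ℝ) : Measure ℝ :=
  ((gaussianReal 0 1).prod (chiSq ν)).map (fun z => (z.1 + w) / √(z.2 / ν))

/-- The law of `W = √(φ² / (1 - φ²) · χ²_v)`. -/
def lawW (φ : ℝ) (v : ℕ) : Measure ℝ :=
  (chiSq v).map (fun x => √(φ ^ 2 / (1 - φ ^ 2) * x))

/-! ### The statistic -/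

/-- The degrees of freedom `v = n (n - 3) / 2` (the division is exact for `n ≥ 3`). -/
def dof (n : ℕ) : ℕ := n * (n - 3) / 2

/-- The `𝒰`-centered version of an `n × n` matrix. -/
def uCenter {n : ℕ} (A : Matrix (Fin n) (Fin n) ℝ) : Matrix (Fin n) (Fin n) ℝ :=
  Matrix.of fun s t =>
    if s = t then 0
    else A s t - 1 / ((n : ℝ) - 2) * ∑ v, A s v - 1 / ((n : ℝ) - 2) * ∑ u, A u t
      + 1 / (((n : ℝ) - 1) * ((n : ℝ) - 2)) * ∑ u, ∑ v, A u v

/-- The inner product `(n (n - 3))⁻¹ ∑_{s ≠ t} a_st b_st` of `𝒰`-centered matrices. -/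
def uInner {n : ℕ} (A B : Matrix (Fin n) (Fin n) ℝ) : ℝ :=
  1 / ((n : ℝ) * ((n : ℝ) - 3)) * ∑ s, ∑ t ∈ Finset.univ.erase s, A s t * B s t

section Statistic

variable {Ω : Type*} [MeasurableSpace Ω] {n p q : ℕ}

/-- The double centered kernel distances of a real sample `x₁, …, xₙ`: for `s ≠ t`,
`k_st = k(x_s, x_t) - E[k(x_s, x_t) | x_s] - E[k(x_s, x_t) | x_t] + E[k(x_s, x_t)]`,
and `k_ss = 0`. (If `k` is constant on the diagonal, like the distances `|x - y|` and
`|x - y|²`, the formula with `s = t` also gives `0` almost surely.) -/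
def kernelDist (P : Measure Ω) (k : ℝ → ℝ → ℝ) (x : Fin n → Ω → ℝ) (s t : Fin n) (ω : Ω) : ℝ :=
  if s = t then 0
  else
    k (x s ω) (x t ω)
      - (P[fun ω' => k (x s ω') (x t ω') | MeasurableSpace.comap (x s) inferInstance]) ω
      - (P[fun ω' => k (x s ω') (x t ω') | MeasurableSpace.comap (x t) inferInstance]) ω
      + ∫ ω', k (x s ω') (x t ω') ∂P

/-- The double centered kernel distances `k_st(i)` of the `i`-th coordinate of a sample of random
vectors, as a random matrix. -/
def kernelMat (P : Measure Ω) (k : ℝ → ℝ → ℝ) (X : Fin n → Ω → Fin p → ℝ) (i : Fin p) (ω : Ω) :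
    Matrix (Fin n) (Fin n) ℝ :=
  Matrix.of fun s t => kernelDist P k (fun r ω' => X r ω' i) s t ω

/-- The unified sample covariance `uCov²ₙ(𝐗, 𝐘)`, with kernel `k` for `𝐗` and `l` for `𝐘`. -/
def uCov (P : Measure Ω) (k l : ℝ → ℝ → ℝ) (X : Fin n → Ω → Fin p → ℝ)
    (Y : Fin n → Ω → Fin q → ℝ) (ω : Ω) : ℝ :=
  1 / √((p : ℝ) * (q : ℝ)) *
    ∑ i, ∑ j, uInner (uCenter (kernelMat P k X i ω)) (uCenter (kernelMat P l Y j ω))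

/-- The unified sample correlation `uCor²ₙ(𝐗, 𝐘)`. -/
def uCor (P : Measure Ω) (k l : ℝ → ℝ → ℝ) (X : Fin n → Ω → Fin p → ℝ)
    (Y : Fin n → Ω → Fin q → ℝ) (ω : Ω) : ℝ :=
  uCov P k l X Y ω / √(uCov P k k X X ω * uCov P l l Y Y ω)

/-- The studentized statistic `T_u`. -/
def studentized (P : Measure Ω) (k l : ℝ → ℝ → ℝ) (X : Fin n → Ω → Fin p → ℝ)
    (Y : Fin n → Ω → Fin q → ℝ) (ω : Ω) : ℝ :=
  √((dof n : ℝ) - 1) * (uCor P k l X Y ω / √(1 - uCor P k l X Y ω ^ 2))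

/-- `(X₁, Y₁), …, (Xₙ, Yₙ)` are independent and identically distributed pairs of random
vectors. (`X_s` and `Y_s` may depend on each other.) -/
structure IsIIDSample (P : Measure Ω) (X : Fin n → Ω → Fin p → ℝ)
    (Y : Fin n → Ω → Fin q → ℝ) : Prop where
  measurable_X : ∀ s, Measurable (X s)
  measurable_Y : ∀ s, Measurable (Y s)
  indep : iIndepFun (fun s ω => (X s ω, Y s ω)) P
  identDistrib : ∀ s t,
    IdentDistrib (fun ω => (X s ω, Y s ω)) (fun ω => (X t ω, Y t ω)) P P

end Statistic

/-! ### Assumptions on the array of samples, indexed by `d = (p, q)` -/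

section Assumptions

variable {n : ℕ} {Ω : ℕ × ℕ → Type*} [∀ d, MeasurableSpace (Ω d)]

/-- The coordinates of the vectors have variances bounded away from zero and bounded second
moments, uniformly in the coordinate and in the dimensions. -/
def BoundedMoments (P : ∀ d, Measure (Ω d)) {dim : ℕ × ℕ → ℕ}
    (X : ∀ d, Fin n → Ω d → Fin (dim d) → ℝ) : Prop :=
  ∃ a b : ℝ, 0 < a ∧ ∀ d s i,
    MemLp (fun ω => X d s ω i) 2 (P d) ∧
    a ≤ Var[fun ω => X d s ω i; P d] ∧
    ∫ ω, X d s ω i ^ 2 ∂(P d) ≤ b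

/-- The means and covariances of double centered kernel distances exist: `k(x_si, x_ti)` is
integrable and `k_st(i)` is square integrable. -/
def KernelMoments (P : ∀ d, Measure (Ω d)) (k : ℝ → ℝ → ℝ) {dim : ℕ × ℕ → ℕ}
    (X : ∀ d, Fin n → Ω d → Fin (dim d) → ℝ) : Prop :=
  ∀ d (s t : Fin n), s ≠ t → ∀ i,
    Integrable (fun ω => k (X d s ω i) (X d t ω i)) (P d) ∧
    MemLp (fun ω => kernelMat (P d) k (X d) i ω s t) 2 (P d)

/-- The index set `{(s, t) : s < t}`. -/
abbrev Pairs (n : ℕ) : Type := {e : Fin n × Fin n // e.1 < e.2}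

/-- The random vector `(p^{-1/2} ∑ᵢ k_st(i))_{s < t}`. -/
def normSum {Ω' : Type*} [MeasurableSpace Ω'] {p : ℕ} (P : Measure Ω') (k : ℝ → ℝ → ℝ)
    (X : Fin n → Ω' → Fin p → ℝ) (ω : Ω') : Pairs n → ℝ :=
  fun e => 1 / √(p : ℝ) * ∑ i, kernelMat P k X i ω e.1.1 e.1.2

/-- The central limit assumption: as `p ∧ q → ∞`, the vectors `(p^{-1/2} ∑ᵢ k_st(i))_{s < t}` and
`(q^{-1/2} ∑ⱼ l_uv(j))_{u < v}` converge jointly in distribution to a jointly Gaussian vector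
`(c_st, d_uv)`, whose covariances `var c_st = σ_x²`, `var d_st = σ_y²` and
`cov(c_st, d_st) = σ_xy²` are the limits of the corresponding covariances. -/
structure KernelCLT (P : ∀ d, Measure (Ω d)) [∀ d, IsProbabilityMeasure (P d)]
    (k l : ℝ → ℝ → ℝ) (X : ∀ d : ℕ × ℕ, Fin n → Ω d → Fin d.1 → ℝ)
    (Y : ∀ d : ℕ × ℕ, Fin n → Ω d → Fin d.2 → ℝ) (σx σy σxy : ℝ) : Prop where
  tendsto_gaussian :
    ∃ (γ : Measure ((Pairs n → ℝ) × (Pairs n → ℝ))) (_ : IsGaussian γ),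
      TendstoInDistribution
        (fun d ω => (normSum (P d) k (X d) ω, normSum (P d) l (Y d) ω))
        (atTop : Filter (ℕ × ℕ)) (fun z => z) P γ ∧
      ∀ e : Pairs n,
        Var[fun z => z.1 e; γ] = σx ^ 2 ∧
        Var[fun z => z.2 e; γ] = σy ^ 2 ∧
        cov[fun z => z.1 e, fun z => z.2 e; γ] = σxy ^ 2
  tendsto_x : ∀ s t : Fin n, s < t →
    Tendsto (fun d : ℕ × ℕ => 1 / (d.1 : ℝ) * ∑ i, ∑ j,
        cov[fun ω => kernelMat (P d) k (X d) i ω s t,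
          fun ω => kernelMat (P d) k (X d) j ω s t; P d])
      atTop (𝓝 (σx ^ 2))
  tendsto_y : ∀ s t : Fin n, s < t →
    Tendsto (fun d : ℕ × ℕ => 1 / (d.2 : ℝ) * ∑ i, ∑ j,
        cov[fun ω => kernelMat (P d) l (Y d) i ω s t,
          fun ω => kernelMat (P d) l (Y d) j ω s t; P d])
      atTop (𝓝 (σy ^ 2))
  tendsto_xy : ∀ s t : Fin n, s < t →
    Tendsto (fun d : ℕ × ℕ => 1 / √((d.1 : ℝ) * (d.2 : ℝ)) * ∑ i, ∑ j,
        cov[fun ω => kernelMat (P d) k (X d) i ω s t,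
          fun ω => kernelMat (P d) l (Y d) j ω s t; P d])
      atTop (𝓝 (σxy ^ 2))

end Assumptions

end HDIndep

end

open HDIndep

/-!
Double centering makes the kernels degenerate, so distances of different pairs `(s, t)` are
uncorrelated even when `X` and `Y` are dependent. Along the central limit theorem variances
converge, and then Fatou's lemma carries the covariances to the limit: the Gaussian pairs
`(c_st, d_st)` are independent across `s < t`, with correlation `φ` inside each pair.
Since `𝒰`-centering is the orthogonal projection onto the `v`-dimensional space of symmetric
hollow matrices with zero row sums, the limit of `uCor²ₙ` is the cosine of the angle between two
standard Gaussian vectors of dimension `v` with correlation `φ`. Rotating the first vector onto a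
coordinate axis turns the studentized cosine into a noncentral `t` variable whose noncentrality is
proportional to the length of that vector, hence distributed as `W`.
-/

namespace HDIndep

section LinearAlgebra

open Finset Matrix

lemma exists_orthonormal_coordinates {ι : Type*} [Fintype ι] {m : ℕ}
    (H : Submodule ℝ (EuclideanSpace ℝ ι)) (hH : Module.finrank ℝ H = m) :
    ∃ W : Matrix (Fin m) ι ℝ, W * Wᵀ = 1 ∧ ∀ c d : EuclideanSpace ℝ ι,
      (W *ᵥ c) ⬝ᵥ (W *ᵥ d) = inner ℝ (H.starProjection c) (H.starProjection d) := by
  let b : OrthonormalBasis (Fin m) ℝ H := (stdOrthonormalBasis ℝ H).reindex (finCongr hH)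
  let W : Matrix (Fin m) ι ℝ := .of fun i e => (b i : EuclideanSpace ℝ ι) e
  have hW (c : EuclideanSpace ℝ ι) (i : Fin m) :
      (W *ᵥ c) i = inner ℝ (b i) (H.orthogonalProjectionOnto c) := by
    rw [Submodule.inner_orthogonalProjectionOnto_eq_of_mem_left,
      EuclideanSpace.inner_eq_star_dotProduct, dotProduct_comm]
    rfl
  refine ⟨W, ?_, fun c d => ?_⟩
  · ext i j
    have h := orthonormal_iff_ite.1 b.orthonormal j i
    rw [Submodule.coe_inner, EuclideanSpace.inner_eq_star_dotProduct, star_trivial] at h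
    exact h.trans (by simp only [one_apply, eq_comm])
  · rw [Submodule.starProjection_apply, Submodule.starProjection_apply, ← Submodule.coe_inner,
      ← b.sum_inner_mul_inner]
    exact sum_congr rfl fun i _ => by rw [hW, hW, real_inner_comm]

variable {n : ℕ}

/-- The symmetric matrix with zero diagonal and prescribed entries above the diagonal. -/
def symMat : (Pairs n → ℝ) →ₗ[ℝ] Matrix (Fin n) (Fin n) ℝ where
  toFun c := .of fun s t =>
    if h : s < t then c ⟨(s, t), h⟩ else if h : t < s then c ⟨(t, s), h⟩ else 0
  map_add' c d := by
    ext s t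
    simp only [of_apply, Matrix.add_apply, Pi.add_apply]
    split_ifs <;> simp
  map_smul' r c := by
    ext s t
    simp only [of_apply, Matrix.smul_apply, Pi.smul_apply]
    split_ifs <;> simp

lemma symMat_of_lt (c : Pairs n → ℝ) {s t : Fin n} (h : s < t) :
    symMat c s t = c ⟨(s, t), h⟩ := by
  simp [symMat, h]

@[simp] lemma symMat_pair (c : Pairs n → ℝ) (e : Pairs n) : symMat c e.1.1 e.1.2 = c e :=
  symMat_of_lt c e.2

lemma symMat_comm (c : Pairs n → ℝ) (s t : Fin n) : symMat c s t = symMat c t s := by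
  rcases lt_trichotomy s t with h | h | h
  · simp [symMat, h, h.not_gt]
  · rw [h]
  · simp [symMat, h, h.not_gt]

@[simp] lemma symMat_self (c : Pairs n → ℝ) (s : Fin n) : symMat c s s = 0 := by
  simp [symMat]

lemma eq_symMat {A : Matrix (Fin n) (Fin n) ℝ} (hA : ∀ s t, A s t = A t s)
    (h0 : ∀ s, A s s = 0) : A = symMat fun e => A e.1.1 e.1.2 := by
  ext s t
  rcases lt_trichotomy s t with h | h | h
  · rw [symMat_of_lt _ h]
  · rw [h, h0, symMat_self]
  · rw [symMat_comm, symMat_of_lt _ h, hA]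

lemma sum_erase_eq_two_mul_sum_pairs {f : Fin n → Fin n → ℝ} (hf : ∀ s t, f s t = f t s) :
    ∑ s, ∑ t ∈ univ.erase s, f s t = 2 * ∑ e : Pairs n, f e.1.1 e.1.2 := by
  have hlt : ∑ e : Pairs n, f e.1.1 e.1.2 = ∑ s, ∑ t, if s < t then f s t else 0 := by
    rw [← Fintype.sum_prod_type' (f := fun s t => if s < t then f s t else 0), ← sum_filter,
      Finset.sum_subtype (p := fun e : Fin n × Fin n => e.1 < e.2)]
    simp
  have hgt : ∑ s, ∑ t, (if s < t then f s t else 0) = ∑ s, ∑ t, if t < s then f s t else 0 := by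
    rw [sum_comm]
    exact sum_congr rfl fun s _ => sum_congr rfl fun t _ => by rw [hf]
  rw [two_mul, hlt]
  nth_rewrite 2 [hgt]
  simp only [← sum_add_distrib, ← Finset.filter_ne', sum_filter]
  refine sum_congr rfl fun s _ => sum_congr rfl fun t _ => ?_
  rcases lt_trichotomy s t with h | h | h
  · simp [h, h.not_gt, h.ne']
  · simp [h]
  · simp [h, h.not_gt, h.ne]

lemma card_pairs : (Fintype.card (Pairs n) : ℝ) = n * (n - 1) / 2 := by
  have h := sum_erase_eq_two_mul_sum_pairs (n := n) (f := fun _ _ => 1) (fun _ _ => rfl)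
  rcases Nat.eq_zero_or_pos n with rfl | hn
  · simp at h ⊢
  · simp [Nat.cast_sub hn] at h
    linarith

lemma dof_cast (hn : 3 ≤ n) : (dof n : ℝ) = n * (n - 3) / 2 := by
  have hdvd : 2 ∣ n * (n - 3) := by
    obtain ⟨m, rfl⟩ := Nat.exists_eq_add_of_le hn
    rw [Nat.add_sub_cancel_left, ← even_iff_two_dvd]
    grind
  rw [dof, Nat.cast_div hdvd (by norm_num)]
  push_cast [Nat.cast_sub hn]
  ring

lemma two_le_dof (hn : 4 ≤ n) : 2 ≤ dof n := by
  have hn' : (4 : ℝ) ≤ n := by exact_mod_cast hn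
  have : (2 : ℝ) ≤ dof n := by
    rw [dof_cast (by omega)]
    nlinarith
  exact_mod_cast this

/-- The row sums of the symmetric matrix with zero diagonal and prescribed entries above the
diagonal. -/
def rowSums : (Pairs n → ℝ) →ₗ[ℝ] Fin n → ℝ where
  toFun c s := ∑ t, symMat c s t
  map_add' c d := by ext s; simp [sum_add_distrib]
  map_smul' r c := by ext s; simp [mul_sum]

lemma rowSums_apply (c : Pairs n → ℝ) (s : Fin n) : rowSums c s = ∑ t, symMat c s t := rfl

/-- The vector with entries `z s + z t` at `s < t`: the adjoint of `rowSums` at `z`. -/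
def pairSums (z : Fin n → ℝ) : Pairs n → ℝ := fun e => z e.1.1 + z e.1.2

lemma symMat_pairSums (z : Fin n → ℝ) {s t : Fin n} (hst : s ≠ t) :
    symMat (pairSums z) s t = z s + z t := by
  rcases hst.lt_or_gt with h | h
  · rw [symMat_of_lt _ h, pairSums]
  · rw [symMat_comm, symMat_of_lt _ h, pairSums, add_comm]

lemma rowSums_pairSums (z : Fin n → ℝ) (s : Fin n) :
    rowSums (pairSums z) s = (n - 2) * z s + ∑ t, z t := by
  rw [rowSums_apply, ← Finset.add_sum_erase _ _ (mem_univ s), symMat_self, zero_add,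
    sum_congr rfl fun t ht => symMat_pairSums z (ne_of_mem_erase ht).symm, sum_add_distrib,
    sum_erase_eq_sub (mem_univ s), sum_erase_eq_sub (mem_univ s), sum_const, card_univ,
    Fintype.card_fin, nsmul_eq_mul]
  ring

lemma dotProduct_pairSums (c : Pairs n → ℝ) (z : Fin n → ℝ) :
    c ⬝ᵥ pairSums z = rowSums c ⬝ᵥ z := by
  have h := sum_erase_eq_two_mul_sum_pairs (f := fun s t => symMat c s t * (z s + z t))
    fun s t => by rw [symMat_comm, add_comm]
  have herase (s : Fin n) : ∑ t ∈ univ.erase s, symMat c s t * (z s + z t)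
      = ∑ t, symMat c s t * (z s + z t) := sum_erase _ (by simp)
  have hswap : ∑ s, ∑ t, symMat c s t * z t = ∑ s, ∑ t, symMat c s t * z s := by
    rw [sum_comm]
    exact sum_congr rfl fun s _ => sum_congr rfl fun t _ => by rw [symMat_comm]
  simp only [herase] at h
  simp only [mul_add, sum_add_distrib, hswap, symMat_pair] at h
  simp only [dotProduct, pairSums, rowSums_apply, sum_mul, mul_add, sum_add_distrib]
  linarith

/-- The vector whose `pairSums` have row sums `y` (for `3 ≤ n`). Subtracting its `pairSums` is
`𝒰`-centering. -/
noncomputable def rowEffects (y : Fin n → ℝ) : Fin n → ℝ := fun s =>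
  1 / ((n : ℝ) - 2) * y s - 1 / 2 * (1 / (((n : ℝ) - 1) * ((n : ℝ) - 2)) * ∑ u, y u)

lemma rowSums_pairSums_rowEffects (hn : 3 ≤ n) (y : Fin n → ℝ) :
    rowSums (pairSums (rowEffects y)) = y := by
  have hn' : (3 : ℝ) ≤ n := by exact_mod_cast hn
  ext s
  simp only [rowSums_pairSums, rowEffects, sum_sub_distrib, ← mul_sum, sum_const, card_univ,
    Fintype.card_fin, nsmul_eq_mul]
  field_simp [show (n : ℝ) - 1 ≠ 0 by linarith, show (n : ℝ) - 2 ≠ 0 by linarith]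
  ring

/-- `𝒰`-centering of the entries above the diagonal. -/
noncomputable def centerPairs (c : Pairs n → ℝ) : Pairs n → ℝ :=
  c - pairSums (rowEffects (rowSums c))

lemma uCenter_symMat (c : Pairs n → ℝ) : uCenter (symMat c) = symMat (centerPairs c) := by
  ext s t
  rcases eq_or_ne s t with rfl | hst
  · simp [uCenter]
  · have hcol : ∑ u, symMat c u t = ∑ v, symMat c t v :=
      sum_congr rfl fun u _ => symMat_comm c u t
    rw [centerPairs, map_sub, Matrix.sub_apply, symMat_pairSums _ hst]
    simp only [uCenter, of_apply, if_neg hst, hcol, rowEffects, rowSums_apply]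
    ring

/-- The space of symmetric matrices with zero diagonal and zero row sums, parametrized by their
entries above the diagonal. -/
def zeroRowSums (n : ℕ) : Submodule ℝ (EuclideanSpace ℝ (Pairs n)) :=
  LinearMap.ker (rowSums ∘ₗ (WithLp.linearEquiv 2 ℝ (Pairs n → ℝ)).toLinearMap)

lemma mem_zeroRowSums {c : EuclideanSpace ℝ (Pairs n)} :
    c ∈ zeroRowSums n ↔ rowSums c = 0 := Iff.rfl

lemma starProjection_zeroRowSums (hn : 3 ≤ n) (c : Pairs n → ℝ) :
    (zeroRowSums n).starProjection (WithLp.toLp 2 c) = WithLp.toLp 2 (centerPairs c) := by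
  refine Submodule.eq_starProjection_of_mem_of_inner_eq_zero ?_ fun w hw => ?_
  · rw [mem_zeroRowSums, centerPairs, map_sub, rowSums_pairSums_rowEffects hn, sub_self]
  · rw [EuclideanSpace.inner_eq_star_dotProduct, WithLp.ofLp_sub, centerPairs, sub_sub_cancel,
      star_trivial, dotProduct_pairSums, mem_zeroRowSums.1 hw, zero_dotProduct]

lemma finrank_zeroRowSums (hn : 3 ≤ n) : Module.finrank ℝ (zeroRowSums n) = dof n := by
  have hsurj : Function.Surjective
      (rowSums ∘ₗ (WithLp.linearEquiv 2 ℝ (Pairs n → ℝ)).toLinearMap) :=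
    fun y => ⟨WithLp.toLp 2 _, rowSums_pairSums_rowEffects hn y⟩
  have hrank := LinearMap.finrank_range_add_finrank_ker
    (rowSums ∘ₗ (WithLp.linearEquiv 2 ℝ (Pairs n → ℝ)).toLinearMap)
  rw [LinearMap.range_eq_top.2 hsurj, finrank_top, Module.finrank_fin_fun,
    finrank_euclideanSpace] at hrank
  have hcast : (n : ℝ) + Module.finrank ℝ (zeroRowSums n) = n * (n - 1) / 2 := by
    rw [← card_pairs]
    exact_mod_cast hrank
  have : (Module.finrank ℝ (zeroRowSums n) : ℝ) = dof n := by
    rw [dof_cast hn]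
    linarith
  exact_mod_cast this

lemma uInner_symMat (hn : 3 ≤ n) (c d : Pairs n → ℝ) :
    uInner (symMat c) (symMat d) = (dof n : ℝ)⁻¹ * (c ⬝ᵥ d) := by
  rw [uInner, dof_cast hn, sum_erase_eq_two_mul_sum_pairs fun s t => by
    rw [symMat_comm, symMat_comm d]]
  simp only [symMat_pair, dotProduct]
  rw [← mul_assoc, inv_div]
  ring

lemma exists_uInner_uCenter_symMat (hn : 3 ≤ n) :
    ∃ W : Matrix (Fin (dof n)) (Pairs n) ℝ, W * Wᵀ = 1 ∧ ∀ c d : Pairs n → ℝ,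
      uInner (uCenter (symMat c)) (uCenter (symMat d))
        = (dof n : ℝ)⁻¹ * ((W *ᵥ c) ⬝ᵥ (W *ᵥ d)) := by
  obtain ⟨W, hW, hdot⟩ := exists_orthonormal_coordinates _ (finrank_zeroRowSums hn)
  refine ⟨W, hW, fun c d => ?_⟩
  rw [uCenter_symMat, uCenter_symMat, uInner_symMat hn,
    hdot (WithLp.toLp 2 c) (WithLp.toLp 2 d), starProjection_zeroRowSums hn,
    starProjection_zeroRowSums hn, EuclideanSpace.inner_eq_star_dotProduct, star_trivial,
    dotProduct_comm]

end LinearAlgebra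

section Gaussian

open Matrix

variable {ι κ : Type*} [Fintype ι]

/-- The standard Gaussian measure on `ι → ℝ`. -/
noncomputable abbrev stdPi (ι : Type*) [Fintype ι] : Measure (ι → ℝ) :=
  Measure.pi fun _ => gaussianReal 0 1

lemma map_eq_stdPi_of_covariance [DecidableEq ι] {Ω : Type*} [MeasurableSpace Ω] {μ : Measure Ω}
    {X : Ω → ι → ℝ} (hX : HasGaussianLaw X μ) (hmean : ∀ i, ∫ ω, X ω i ∂μ = 0)
    (hcov : ∀ i j, cov[fun ω => X ω i, fun ω => X ω j; μ] = if i = j then 1 else 0) :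
    μ.map X = stdPi ι := by
  have := hX.isProbabilityMeasure
  have hind : iIndepFun (fun i ω => X ω i) μ :=
    HasGaussianLaw.iIndepFun_of_covariance_eq_zero hX fun i j hij => by
      simpa only [if_neg hij] using hcov i j
  refine ((iIndepFun_iff_map_fun_eq_pi_map fun i => hX.aemeasurable.eval i).1 hind).trans ?_
  congr 1
  ext1 i
  rw [(hX.eval i).map_eq_gaussianReal, hmean, ← covariance_self (hX.eval i).aemeasurable,
    hcov, if_pos rfl, Real.toNNReal_one]

lemma hasGaussianLaw_stdPi : HasGaussianLaw (fun z : ι → ℝ => z) (stdPi ι) :=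
  iIndepFun.hasGaussianLaw (X := fun i (z : ι → ℝ) => z i)
    (fun i => ((measurePreserving_eval (fun _ : ι => gaussianReal 0 1) i).hasLaw).hasGaussianLaw)
    (iIndepFun_pi (X := fun _ x => x) fun _ => aemeasurable_id)

lemma integral_eval_stdPi (i : ι) : ∫ z, z i ∂(stdPi ι) = 0 :=
  ((measurePreserving_eval (fun _ : ι => gaussianReal 0 1) i).hasLaw.integral_eq).trans
    integral_id_gaussianReal

lemma covariance_eval_stdPi [DecidableEq ι] (i j : ι) :
    cov[fun z => z i, fun z => z j; stdPi ι] = if i = j then 1 else 0 := by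
  split_ifs with hij
  · subst hij
    rw [covariance_self (measurable_pi_apply i).aemeasurable]
    exact ((measurePreserving_eval (fun _ : ι => gaussianReal 0 1) i).hasLaw.variance_eq).trans
      variance_id_gaussianReal
  · have hind : iIndepFun (fun i (z : ι → ℝ) => z i) (stdPi ι) :=
      iIndepFun_pi (X := fun _ x => x) fun _ => aemeasurable_id
    exact (hind.indepFun hij).covariance_eq_zero
      (hasGaussianLaw_stdPi.eval i).memLp_two (hasGaussianLaw_stdPi.eval j).memLp_two

lemma integral_mulVec_stdPi (U : Matrix κ ι ℝ) (i : κ) : ∫ z, (U *ᵥ z) i ∂(stdPi ι) = 0 := by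
  simp only [mulVec, dotProduct]
  rw [integral_finsetSum _ fun e _ => (hasGaussianLaw_stdPi.eval e).integrable.const_mul _]
  simp only [integral_const_mul, integral_eval_stdPi, mul_zero, Finset.sum_const_zero]

lemma covariance_mulVec_stdPi (U : Matrix κ ι ℝ) (i j : κ) :
    cov[fun z => (U *ᵥ z) i, fun z => (U *ᵥ z) j; stdPi ι] = (U * Uᵀ) i j := by
  classical
  simp only [mulVec, dotProduct]
  rw [covariance_fun_sum_fun_sum
    (fun e => (hasGaussianLaw_stdPi.eval e).memLp_two.const_mul _)
    (fun e => (hasGaussianLaw_stdPi.eval e).memLp_two.const_mul _)]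
  simp only [covariance_const_mul_left, covariance_const_mul_right, covariance_eval_stdPi,
    mul_ite, mul_one, mul_zero, Finset.sum_ite_eq, Finset.mem_univ, if_true, mul_apply,
    transpose_apply, mul_comm]

lemma map_mulVec_stdPi [Fintype κ] [DecidableEq κ] {U : Matrix κ ι ℝ} (hU : U * Uᵀ = 1) :
    (stdPi ι).map (fun z => U *ᵥ z) = stdPi κ :=
  map_eq_stdPi_of_covariance
    (hasGaussianLaw_stdPi.map_fun (LinearMap.toContinuousLinearMap U.mulVecLin))
    (integral_mulVec_stdPi U) fun i j => by rw [← one_apply, ← hU, ← covariance_mulVec_stdPi]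

lemma covariance_residual {α Ω : Type*} [DecidableEq α] [MeasurableSpace Ω] {μ : Measure Ω}
    [IsFiniteMeasure μ] {X Y : Ω → α → ℝ} {φ : ℝ} (hφ : φ ^ 2 < 1)
    (hX : ∀ i, MemLp (fun ω => X ω i) 2 μ) (hY : ∀ i, MemLp (fun ω => Y ω i) 2 μ)
    (hX_cov : ∀ i j, cov[fun ω => X ω i, fun ω => X ω j; μ] = if i = j then 1 else 0)
    (hY_cov : ∀ i j, cov[fun ω => Y ω i, fun ω => Y ω j; μ] = if i = j then 1 else 0)
    (hXY_cov : ∀ i j, cov[fun ω => X ω i, fun ω => Y ω j; μ] = if i = j then φ else 0)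
    (i j : α) :
    cov[fun ω => (√(1 - φ ^ 2))⁻¹ * (Y ω i - φ * X ω i),
      fun ω => (√(1 - φ ^ 2))⁻¹ * (Y ω j - φ * X ω j); μ] = if i = j then 1 else 0 := by
  have hφX (i : α) := (hX i).const_mul φ
  simp only [covariance_const_mul_left, covariance_const_mul_right]
  rw [covariance_fun_sub_fun_sub (hY i) (hφX i) (hY j) (hφX j)]
  simp only [covariance_const_mul_left, covariance_const_mul_right, hX_cov, hY_cov, hXY_cov,
    covariance_comm (fun ω => Y ω i), eq_comm (a := j)]
  rw [← mul_assoc, ← mul_inv, Real.mul_self_sqrt (by linarith)]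
  split_ifs
  · field_simp [show 1 - φ ^ 2 ≠ 0 by linarith]
    ring
  · ring

/-- Gram-Schmidt for two Gaussian vectors with componentwise correlation `φ`. -/
theorem map_residual_eq_stdPi_prod [DecidableEq ι] {Ω : Type*} [MeasurableSpace Ω]
    {μ : Measure Ω} {X Y : Ω → ι → ℝ} {φ : ℝ} (hφ : φ ^ 2 < 1)
    (hXY : HasGaussianLaw (fun ω => (X ω, Y ω)) μ)
    (hX_mean : ∀ i, ∫ ω, X ω i ∂μ = 0) (hY_mean : ∀ i, ∫ ω, Y ω i ∂μ = 0)
    (hX_cov : ∀ i j, cov[fun ω => X ω i, fun ω => X ω j; μ] = if i = j then 1 else 0)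
    (hY_cov : ∀ i j, cov[fun ω => Y ω i, fun ω => Y ω j; μ] = if i = j then 1 else 0)
    (hXY_cov : ∀ i j, cov[fun ω => X ω i, fun ω => Y ω j; μ] = if i = j then φ else 0) :
    μ.map (fun ω => (X ω, (√(1 - φ ^ 2))⁻¹ • (Y ω - φ • X ω)))
      = (stdPi ι).prod (stdPi ι) := by
  have := hXY.isProbabilityMeasure
  have hX := hXY.fst
  have hY := hXY.snd
  set R : Ω → ι → ℝ := fun ω => (√(1 - φ ^ 2))⁻¹ • (Y ω - φ • X ω) with hR
  have hXR : HasGaussianLaw (fun ω => (X ω, R ω)) μ :=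
    hXY.map_fun ((ContinuousLinearMap.fst ℝ (ι → ℝ) (ι → ℝ)).prod ((√(1 - φ ^ 2))⁻¹ •
      (ContinuousLinearMap.snd ℝ (ι → ℝ) (ι → ℝ)
        - φ • ContinuousLinearMap.fst ℝ (ι → ℝ) (ι → ℝ))))
  have hR_mean (i : ι) : ∫ ω, R ω i ∂μ = 0 := by
    simp only [hR, Pi.smul_apply, Pi.sub_apply, smul_eq_mul, integral_const_mul]
    rw [integral_sub (hY.eval i).integrable ((hX.eval i).integrable.const_mul φ),
      integral_const_mul, hX_mean, hY_mean]
    ring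
  have hXR_cov (i j : ι) : cov[fun ω => X ω i, fun ω => R ω j; μ] = 0 := by
    simp only [hR, Pi.smul_apply, Pi.sub_apply, smul_eq_mul, covariance_const_mul_right]
    rw [covariance_fun_sub_right (hX.eval i).memLp_two (hY.eval j).memLp_two
        ((hX.eval j).memLp_two.const_mul φ),
      covariance_const_mul_right, hX_cov, hXY_cov]
    split_ifs <;> ring
  have hR_cov := covariance_residual hφ (fun i => (hX.eval i).memLp_two)
    (fun i => (hY.eval i).memLp_two) hX_cov hY_cov hXY_cov
  rw [(indepFun_iff_map_prod_eq_prod_map_map hXR.fst.aemeasurable hXR.snd.aemeasurable).1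
      (HasGaussianLaw.indepFun_of_covariance_eval (X := fun i ω => X ω i)
        (Y := fun i ω => R ω i) hXR hXR_cov),
    map_eq_stdPi_of_covariance hX hX_mean hX_cov,
    map_eq_stdPi_of_covariance hXR.snd hR_mean hR_cov]

end Gaussian

section ReferenceLaws

instance (m : ℕ) : IsProbabilityMeasure (chiSq m) :=
  Measure.isProbabilityMeasure_map (Measurable.aemeasurable (by fun_prop))

lemma ae_pos_chiSq {m : ℕ} (hm : m ≠ 0) : ∀ᵐ x ∂(chiSq m), 0 < x := by
  have : NullSingletonClass (gaussianReal 0 1) := nullSingletonClass_gaussianReal one_ne_zero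
  have : NeZero m := ⟨hm⟩
  rw [chiSq, ae_map_iff (Measurable.aemeasurable (by fun_prop)) measurableSet_Ioi]
  filter_upwards [Measure.ae_eval_ne (μ := fun _ : Fin m => gaussianReal 0 1) 0 0] with z hz
  exact Finset.sum_pos' (fun i _ => sq_nonneg (z i)) ⟨0, Finset.mem_univ _, by positivity⟩

lemma measurable_noncentralT (m : ℕ) : Measurable (noncentralT m) := by
  refine Measure.measurable_of_measurable_coe _ fun A hA => ?_
  have hmeas : Measurable fun x : ℝ × ℝ × ℝ => (x.2.1 + x.1) / √(x.2.2 / m) := by fun_prop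
  convert! measurable_measure_prodMk_left (ν := (gaussianReal 0 1).prod (chiSq m)) (hmeas hA)
    using 2 with w
  rw [noncentralT, Measure.map_apply (by fun_prop) hA]
  rfl

lemma noncentralT_singleton {m : ℕ} (hm : m ≠ 0) (w t : ℝ) : noncentralT m w {t} = 0 := by
  have : NullSingletonClass (gaussianReal 0 1) := nullSingletonClass_gaussianReal one_ne_zero
  have hmeas : Measurable fun z : ℝ × ℝ => (z.1 + w) / √(z.2 / m) := by fun_prop
  rw [noncentralT, Measure.map_apply hmeas (measurableSet_singleton t),
    Measure.prod_apply_symm (hmeas (measurableSet_singleton t)), lintegral_eq_zero_iff'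
      (measurable_measure_prodMk_right (hmeas (measurableSet_singleton t))).aemeasurable]
  filter_upwards [ae_pos_chiSq hm] with y hy
  have hpos : 0 < √(y / m) := by positivity
  refine measure_mono_null (fun x hx => ?_) (measure_singleton (t * √(y / m) - w))
  exact eq_sub_of_add_eq ((div_eq_iff hpos.ne').1 hx)

lemma noncentralT_zero (m : ℕ) : noncentralT m 0 = studentT m := by
  simp only [noncentralT, studentT, add_zero]

instance (m : ℕ) (w : ℝ) : IsProbabilityMeasure (noncentralT m w) :=
  Measure.isProbabilityMeasure_map (by fun_prop)

instance (φ : ℝ) (m : ℕ) : IsProbabilityMeasure (lawW φ m) :=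
  Measure.isProbabilityMeasure_map (by fun_prop)

lemma lawW_zero (m : ℕ) : lawW 0 m = Measure.dirac 0 := by
  simp [lawW]

/-- The mixture `t_{m, W}` of noncentral `t` distributions, with `W` as in `lawW φ (m + 1)`. -/
noncomputable def mixedT (φ : ℝ) (m : ℕ) : Measure ℝ := (lawW φ (m + 1)).bind (noncentralT m)

lemma mixedT_apply (φ : ℝ) (m : ℕ) {A : Set ℝ} (hA : MeasurableSet A) :
    mixedT φ m A = ∫⁻ w, noncentralT m w A ∂(lawW φ (m + 1)) :=
  Measure.bind_apply hA (measurable_noncentralT m).aemeasurable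

lemma mixedT_singleton (φ : ℝ) {m : ℕ} (hm : m ≠ 0) (t : ℝ) : mixedT φ m {t} = 0 := by
  simp only [mixedT_apply φ m (measurableSet_singleton t), noncentralT_singleton hm,
    lintegral_zero]

lemma mixedT_real_apply (φ : ℝ) (m : ℕ) {A : Set ℝ} (hA : MeasurableSet A) :
    (mixedT φ m).real A = ∫ w, (noncentralT m w).real A ∂(lawW φ (m + 1)) := by
  rw [measureReal_def, mixedT_apply φ m hA]
  exact (integral_toReal
    ((Measure.measurable_coe hA).comp (measurable_noncentralT m)).aemeasurable
    (.of_forall fun _ => measure_lt_top _ _)).symm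

lemma mixedT_zero (m : ℕ) : mixedT 0 m = studentT m := by
  rw [mixedT, lawW_zero, Measure.dirac_bind (measurable_noncentralT m), noncentralT_zero]

end ReferenceLaws

section CorStat

open Matrix

variable {ι : Type*} [Fintype ι]

/-- The studentized cosine `√m r / √(1 - r²)` of two vectors, with denominators cleared. -/
noncomputable def corStat (m : ℕ) (a b : ι → ℝ) : ℝ :=
  √m * ((a ⬝ᵥ b) / √((a ⬝ᵥ a) * (b ⬝ᵥ b) - (a ⬝ᵥ b) ^ 2))

lemma measurable_corStat (m : ℕ) :
    Measurable fun x : (ι → ℝ) × (ι → ℝ) => corStat m x.1 x.2 := by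
  unfold corStat dotProduct
  fun_prop

lemma corStat_smul_smul (m : ℕ) {σ τ : ℝ} (hσ : 0 < σ) (hτ : 0 < τ) (a b : ι → ℝ) :
    corStat m (σ • a) (τ • b) = corStat m a b := by
  have hgram : (σ • a) ⬝ᵥ (σ • a) * (τ • b) ⬝ᵥ (τ • b) - ((σ • a) ⬝ᵥ (τ • b)) ^ 2
      = (σ * τ) ^ 2 * ((a ⬝ᵥ a) * (b ⬝ᵥ b) - (a ⬝ᵥ b) ^ 2) := by
    simp only [smul_dotProduct, dotProduct_smul, smul_eq_mul]
    ring
  have hnum : (σ • a) ⬝ᵥ (τ • b) = (σ * τ) * (a ⬝ᵥ b) := by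
    simp only [smul_dotProduct, dotProduct_smul, smul_eq_mul]
    ring
  rw [corStat, hgram, hnum, Real.sqrt_mul (sq_nonneg _), Real.sqrt_sq (by positivity),
    mul_div_mul_left _ _ (by positivity), corStat]

lemma dotProduct_mulVec_self [DecidableEq ι] {U : Matrix ι ι ℝ} (hU : U * Uᵀ = 1) (z : ι → ℝ) :
    (U *ᵥ z) ⬝ᵥ (U *ᵥ z) = z ⬝ᵥ z := by
  rw [dotProduct_mulVec, vecMul_mulVec, mul_eq_one_comm.1 hU, vecMul_one]

lemma norm_toLp_eq_sqrt_dotProduct (a : ι → ℝ) : ‖WithLp.toLp 2 a‖ = √(a ⬝ᵥ a) := by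
  rw [norm_eq_sqrt_real_inner, EuclideanSpace.inner_eq_star_dotProduct, star_trivial]

variable {m : ℕ}

lemma exists_orthogonal_mulVec_zero {a : Fin (m + 1) → ℝ} (ha : a ≠ 0) :
    ∃ U : Matrix (Fin (m + 1)) (Fin (m + 1)) ℝ, U * Uᵀ = 1 ∧
      ∀ z, a ⬝ᵥ z = √(a ⬝ᵥ a) * (U *ᵥ z) 0 := by
  let u : EuclideanSpace ℝ (Fin (m + 1)) := WithLp.toLp 2 a
  have hu : u ≠ 0 := fun h => ha (congrArg WithLp.ofLp h)
  have horth : Orthonormal ℝ (({0} : Set (Fin (m + 1))).domRestrict fun _ => ‖u‖⁻¹ • u) :=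
    ⟨fun _ => norm_smul_inv_norm (𝕜 := ℝ) hu,
      fun i j hij => absurd (Subsingleton.elim i j) hij⟩
  obtain ⟨b, hb⟩ := horth.exists_orthonormalBasis_extension_of_card_eq (by simp)
  refine ⟨.of fun i j => b i j, ?_, fun z => ?_⟩
  · ext i j
    have h := orthonormal_iff_ite.1 b.orthonormal j i
    rw [EuclideanSpace.inner_eq_star_dotProduct, star_trivial] at h
    exact h.trans (by simp only [one_apply, eq_comm])
  · have hrow : (Matrix.of fun i j => b i j : Matrix (Fin (m + 1)) (Fin (m + 1)) ℝ) 0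
        = ‖u‖⁻¹ • a := congrArg WithLp.ofLp (hb 0 rfl)
    rw [mulVec, hrow, smul_dotProduct, ← norm_toLp_eq_sqrt_dotProduct, smul_eq_mul,
      mul_inv_cancel_left₀ (norm_ne_zero_iff.2 hu)]

lemma corStat_smul_add_eq {a : Fin (m + 1) → ℝ} (ha : a ≠ 0)
    {U : Matrix (Fin (m + 1)) (Fin (m + 1)) ℝ} (hU : U * Uᵀ = 1)
    (hUa : ∀ z, a ⬝ᵥ z = √(a ⬝ᵥ a) * (U *ᵥ z) 0) (r : ℝ) (z : Fin (m + 1) → ℝ) :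
    corStat m a (r • a + z)
      = ((U *ᵥ z) 0 + r * √(a ⬝ᵥ a)) / √((∑ i : Fin m, (U *ᵥ z) i.succ ^ 2) / m) := by
  have hpos : 0 < a ⬝ᵥ a := by simpa using dotProduct_star_self_pos_iff.2 ha
  have hz : z ⬝ᵥ z = (U *ᵥ z) 0 ^ 2 + ∑ i : Fin m, (U *ᵥ z) i.succ ^ 2 := by
    rw [← dotProduct_mulVec_self hU z]
    simp only [dotProduct, Fin.sum_univ_succ, pow_two]
  have hgram : (a ⬝ᵥ a) * ((r • a + z) ⬝ᵥ (r • a + z)) - (a ⬝ᵥ (r • a + z)) ^ 2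
      = (a ⬝ᵥ a) * ∑ i : Fin m, (U *ᵥ z) i.succ ^ 2 := by
    have hsq : (a ⬝ᵥ z) ^ 2 = (a ⬝ᵥ a) * (U *ᵥ z) 0 ^ 2 := by
      rw [hUa, mul_pow, Real.sq_sqrt hpos.le]
    simp only [dotProduct_add, add_dotProduct, smul_dotProduct, dotProduct_smul, smul_eq_mul,
      dotProduct_comm z a, hz]
    linear_combination -hsq
  have hnum : a ⬝ᵥ (r • a + z) = √(a ⬝ᵥ a) * ((U *ᵥ z) 0 + r * √(a ⬝ᵥ a)) := by
    rw [dotProduct_add, dotProduct_smul, hUa z, smul_eq_mul]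
    linear_combination -r * Real.mul_self_sqrt hpos.le
  rw [corStat, hgram, hnum, Real.sqrt_mul hpos.le,
    mul_div_mul_left _ _ (Real.sqrt_pos.2 hpos).ne',
    Real.sqrt_div (Finset.sum_nonneg fun _ _ => sq_nonneg _), div_div_eq_mul_div]
  ring

lemma map_stdPi_eq_gaussianReal_prod_chiSq (m : ℕ) :
    (stdPi (Fin (m + 1))).map (fun y => (y 0, ∑ i : Fin m, y i.succ ^ 2))
      = (gaussianReal 0 1).prod (chiSq m) := by
  have hsplit := measurePreserving_piFinSuccAbove (fun _ : Fin (m + 1) => gaussianReal 0 1) 0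
  have hsum : Measurable fun y : Fin m → ℝ => ∑ i, y i ^ 2 := by fun_prop
  rw [chiSq, ← Measure.map_id (μ := gaussianReal 0 1), Measure.map_prod_map _ _ measurable_id hsum,
    Measure.map_id, ← hsplit.map_eq,
    Measure.map_map (measurable_id.prodMap hsum) hsplit.measurable]
  rfl

/-- Rotating `a` onto the first axis exhibits the numerator and the denominator as independent. -/
theorem map_corStat_smul_add {a : Fin (m + 1) → ℝ} (ha : a ≠ 0) (r : ℝ) :
    (stdPi (Fin (m + 1))).map (fun z => corStat m a (r • a + z))
      = noncentralT m (r * √(a ⬝ᵥ a)) := by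
  obtain ⟨U, hU, hUa⟩ := exists_orthogonal_mulVec_zero ha
  have hmU : Measurable fun z : Fin (m + 1) → ℝ => U *ᵥ z := by
    unfold mulVec dotProduct
    fun_prop
  have hquot : Measurable fun x : ℝ × ℝ => (x.1 + r * √(a ⬝ᵥ a)) / √(x.2 / m) := by fun_prop
  have hsplit : Measurable fun y : Fin (m + 1) → ℝ => (y 0, ∑ i : Fin m, y i.succ ^ 2) := by
    fun_prop
  rw [noncentralT, ← map_stdPi_eq_gaussianReal_prod_chiSq, Measure.map_map hquot hsplit]
  conv_rhs => rw [← map_mulVec_stdPi hU, Measure.map_map (hquot.comp hsplit) hmU]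
  simp only [corStat_smul_add_eq ha hU hUa]
  rfl

lemma lawW_eq_map_stdPi {φ : ℝ} (hφ : 0 ≤ φ) (hφ_lt : φ < 1) (v : ℕ) :
    lawW φ v = (stdPi (Fin v)).map fun a => φ / √(1 - φ ^ 2) * √(a ⬝ᵥ a) := by
  have hr : √(φ ^ 2 / (1 - φ ^ 2)) = φ / √(1 - φ ^ 2) := by
    rw [Real.sqrt_div (sq_nonneg φ), Real.sqrt_sq hφ]
  have hr_nonneg : 0 ≤ φ ^ 2 / (1 - φ ^ 2) :=
    div_nonneg (sq_nonneg φ) (sub_nonneg.2 (pow_le_one₀ hφ hφ_lt.le))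
  have hnorm (a : Fin v → ℝ) : ∑ i, a i ^ 2 = a ⬝ᵥ a := by simp only [dotProduct, pow_two]
  rw [lawW, chiSq, Measure.map_map (by fun_prop) (by fun_prop)]
  simp only [Function.comp_def, hnorm, Real.sqrt_mul hr_nonneg, hr]

theorem map_corStat_prod_stdPi {φ : ℝ} (hφ : 0 ≤ φ) (hφ_lt : φ < 1) :
    ((stdPi (Fin (m + 1))).prod (stdPi (Fin (m + 1)))).map
        (fun x => corStat m x.1 ((φ / √(1 - φ ^ 2)) • x.1 + x.2))
      = mixedT φ m := by
  have : NullSingletonClass (gaussianReal 0 1) := nullSingletonClass_gaussianReal one_ne_zero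
  have hmeas : Measurable fun x : (Fin (m + 1) → ℝ) × (Fin (m + 1) → ℝ) =>
      corStat m x.1 ((φ / √(1 - φ ^ 2)) • x.1 + x.2) := by
    have hpair : Measurable fun x : (Fin (m + 1) → ℝ) × (Fin (m + 1) → ℝ) =>
      (x.1, (φ / √(1 - φ ^ 2)) • x.1 + x.2) := by fun_prop
    exact (measurable_corStat m).comp hpair
  have hnorm : Measurable fun a : Fin (m + 1) → ℝ => φ / √(1 - φ ^ 2) * √(a ⬝ᵥ a) := by
    unfold dotProduct
    fun_prop
  ext A hA
  rw [Measure.map_apply hmeas hA, Measure.prod_apply (hmeas hA), mixedT_apply φ m hA,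
    lawW_eq_map_stdPi hφ hφ_lt]
  have hcoe : Measurable fun w => noncentralT m w A :=
    (Measure.measurable_coe hA).comp (measurable_noncentralT m)
  rw [lintegral_map hcoe hnorm]
  refine lintegral_congr_ae ?_
  filter_upwards [Measure.ae_eval_ne (μ := fun _ : Fin (m + 1) => gaussianReal 0 1) 0 0] with a ha
  rw [← map_corStat_smul_add (fun h => ha (congrFun h 0))]
  exact (Measure.map_apply (hmeas.comp measurable_prodMk_left) hA).symm

end CorStat

section GaussianLimit

open Matrix

variable {ι : Type*} [Fintype ι] {m : ℕ} {Ω : Type*} [MeasurableSpace Ω]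
  {μ : Measure Ω} {φ : ℝ} {W : Matrix (Fin (m + 1)) ι ℝ}

lemma map_corStat_mulVec_prod_stdPi (hφ : 0 ≤ φ) (hφ_lt : φ < 1) (hW : W * Wᵀ = 1) :
    ((stdPi ι).prod (stdPi ι)).map
        (fun x => corStat m (W *ᵥ x.1) (W *ᵥ ((φ / √(1 - φ ^ 2)) • x.1 + x.2)))
      = mixedT φ m := by
  have hmW : Measurable fun z : ι → ℝ => W *ᵥ z := by
    unfold mulVec dotProduct
    fun_prop
  have hcor : Measurable fun x : (Fin (m + 1) → ℝ) × (Fin (m + 1) → ℝ) =>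
      corStat m x.1 ((φ / √(1 - φ ^ 2)) • x.1 + x.2) := by
    unfold corStat dotProduct
    fun_prop
  rw [← map_corStat_prod_stdPi hφ hφ_lt, ← map_mulVec_stdPi hW,
    Measure.map_prod_map _ _ hmW hmW, Measure.map_map hcor (hmW.prodMap hmW)]
  simp only [Function.comp_def, Prod.map, mulVec_add, mulVec_smul]

variable [DecidableEq ι]

lemma map_corStat_mulVec_of_covariance (hφ : 0 ≤ φ) (hφ_lt : φ < 1) (hW : W * Wᵀ = 1)
    {X Y : Ω → ι → ℝ} (hXY : HasGaussianLaw (fun ω => (X ω, Y ω)) μ)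
    (hX_mean : ∀ i, ∫ ω, X ω i ∂μ = 0) (hY_mean : ∀ i, ∫ ω, Y ω i ∂μ = 0)
    (hX_cov : ∀ i j, cov[fun ω => X ω i, fun ω => X ω j; μ] = if i = j then 1 else 0)
    (hY_cov : ∀ i j, cov[fun ω => Y ω i, fun ω => Y ω j; μ] = if i = j then 1 else 0)
    (hXY_cov : ∀ i j, cov[fun ω => X ω i, fun ω => Y ω j; μ] = if i = j then φ else 0) :
    μ.map (fun ω => corStat m (W *ᵥ X ω) (W *ᵥ Y ω)) = mixedT φ m := by
  have hφ_sq : φ ^ 2 < 1 := pow_lt_one₀ hφ hφ_lt two_ne_zero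
  have hs : 0 < √(1 - φ ^ 2) := Real.sqrt_pos.2 (sub_pos.2 hφ_sq)
  have hY_eq (ω : Ω) : Y ω = √(1 - φ ^ 2) •
      ((φ / √(1 - φ ^ 2)) • X ω + (√(1 - φ ^ 2))⁻¹ • (Y ω - φ • X ω)) := by
    rw [smul_add, smul_smul, smul_smul, mul_div_cancel₀ _ hs.ne', mul_inv_cancel₀ hs.ne',
      one_smul, add_sub_cancel]
  have hcor (ω : Ω) : corStat m (W *ᵥ X ω) (W *ᵥ Y ω) = corStat m (W *ᵥ X ω)
      (W *ᵥ ((φ / √(1 - φ ^ 2)) • X ω + (√(1 - φ ^ 2))⁻¹ • (Y ω - φ • X ω))) := by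
    conv_lhs => rw [hY_eq ω, mulVec_smul, ← one_smul ℝ (W *ᵥ X ω)]
    rw [corStat_smul_smul m one_pos hs]
  have hmeas : Measurable fun x : (ι → ℝ) × (ι → ℝ) =>
      corStat m (W *ᵥ x.1) (W *ᵥ ((φ / √(1 - φ ^ 2)) • x.1 + x.2)) := by
    unfold corStat mulVec dotProduct
    fun_prop
  have hX := hXY.fst.aemeasurable
  have hR : AEMeasurable (fun ω => (√(1 - φ ^ 2))⁻¹ • (Y ω - φ • X ω)) μ :=
    AEMeasurable.const_smul (hXY.snd.aemeasurable.sub (hX.const_smul φ)) (√(1 - φ ^ 2))⁻¹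
  simp only [hcor]
  rw [← map_corStat_mulVec_prod_stdPi hφ hφ_lt hW,
    ← map_residual_eq_stdPi_prod hφ_sq hXY hX_mean hY_mean hX_cov hY_cov hXY_cov,
    AEMeasurable.map_map_of_aemeasurable hmeas.aemeasurable (hX.prodMk hR)]
  rfl

theorem map_corStat_mulVec_eq_mixedT (hφ : 0 ≤ φ) (hφ_lt : φ < 1) (hW : W * Wᵀ = 1)
    {σ τ : ℝ} (hσ : 0 < σ) (hτ : 0 < τ)
    {X Y : Ω → ι → ℝ} (hXY : HasGaussianLaw (fun ω => (X ω, Y ω)) μ)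
    (hX_mean : ∀ i, ∫ ω, X ω i ∂μ = 0) (hY_mean : ∀ i, ∫ ω, Y ω i ∂μ = 0)
    (hX_cov : ∀ i j, cov[fun ω => X ω i, fun ω => X ω j; μ] = if i = j then σ ^ 2 else 0)
    (hY_cov : ∀ i j, cov[fun ω => Y ω i, fun ω => Y ω j; μ] = if i = j then τ ^ 2 else 0)
    (hXY_cov : ∀ i j, cov[fun ω => X ω i, fun ω => Y ω j; μ] = if i = j then σ * τ * φ else 0) :
    μ.map (fun ω => corStat m (W *ᵥ X ω) (W *ᵥ Y ω)) = mixedT φ m := by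
  have hXY' : HasGaussianLaw (fun ω => (σ⁻¹ • X ω, τ⁻¹ • Y ω)) μ :=
    hXY.map_fun ((σ⁻¹ • ContinuousLinearMap.fst ℝ (ι → ℝ) (ι → ℝ)).prod
      (τ⁻¹ • ContinuousLinearMap.snd ℝ (ι → ℝ) (ι → ℝ)))
  have hlaw := map_corStat_mulVec_of_covariance hφ hφ_lt hW hXY'
  simp only [Pi.smul_apply, smul_eq_mul, integral_const_mul, covariance_const_mul_left,
    covariance_const_mul_right, hX_mean, hY_mean, hX_cov, hY_cov, hXY_cov, mul_zero,
    mulVec_smul, corStat_smul_smul m (inv_pos.2 hσ) (inv_pos.2 hτ), mul_ite] at hlaw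
  refine hlaw (fun _ => trivial) (fun _ => trivial) (fun i j => ?_) (fun i j => ?_) (fun i j => ?_)
  all_goals
    congr 1
    field_simp

end GaussianLimit

section Portmanteau

lemma frontier_setOf_le_subset {E : Type*} [TopologicalSpace E] (f : E → ℝ) (t : ℝ) :
    frontier {z | f z ≤ t} ⊆ {z | ¬ContinuousAt f z} ∪ {z | f z = t} := by
  intro z hz
  by_contra h_not_mem
  simp only [Set.mem_union, Set.mem_ofPred_eq, not_or, not_not] at h_not_mem
  obtain ⟨h_cont, h_ne⟩ := h_not_mem
  rw [frontier_eq_closure_inter_closure] at hz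
  rcases lt_or_gt_of_ne h_ne with h_lt | h_gt
  · exact mem_closure_iff_frequently.1 hz.2 ((h_cont.eventually_lt continuousAt_const h_lt).mono
      fun y hy hy' => hy' hy.le)
  · exact mem_closure_iff_frequently.1 hz.1 ((continuousAt_const.eventually_lt h_cont h_gt).mono
      fun y hy hy' => absurd hy (not_lt.2 hy'))

lemma tendsto_measureReal_le_of_tendstoInDistribution {E δ : Type*} [TopologicalSpace E]
    [MeasurableSpace E] [OpensMeasurableSpace E] [HasOuterApproxClosed E] {Ω : δ → Type*}
    [∀ d, MeasurableSpace (Ω d)] {P : ∀ d, Measure (Ω d)} [∀ d, IsProbabilityMeasure (P d)]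
    {γ : Measure E} [IsProbabilityMeasure γ] {X : ∀ d, Ω d → E} {L : Filter δ}
    (hX : TendstoInDistribution X L (fun z => z) P γ) {f : E → ℝ} (hf : Measurable f)
    (hf_cont : ∀ᵐ z ∂γ, ContinuousAt f z) {t : ℝ} (ht : γ {z | f z = t} = 0) :
    Tendsto (fun d => (P d).real {ω | f (X d ω) ≤ t}) L (𝓝 (γ.real {z | f z ≤ t})) := by
  have hmeas : MeasurableSet {z | f z ≤ t} := hf measurableSet_Iic
  have hnull : γ (frontier {z | f z ≤ t}) = 0 :=
    measure_mono_null (frontier_setOf_le_subset f t) (measure_union_null hf_cont ht)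
  have hlim := ProbabilityMeasure.tendsto_measure_of_null_frontier_of_tendsto' hX.tendsto
    (E := {z | f z ≤ t}) (by simpa using hnull)
  simp only [ProbabilityMeasure.coe_mk, Measure.map_id'] at hlim
  refine ((ENNReal.tendsto_toReal (measure_ne_top γ _)).comp hlim).congr fun d => ?_
  rw [Function.comp_apply, Measure.map_apply_of_aemeasurable (hX.forall_aemeasurable d) hmeas]
  rfl

open Matrix

variable {ι : Type*} [Fintype ι]

lemma dotProduct_sq_le (a b : ι → ℝ) : (a ⬝ᵥ b) ^ 2 ≤ (a ⬝ᵥ a) * (b ⬝ᵥ b) := by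
  simpa only [dotProduct, pow_two (a _), pow_two (b _)] using
    Finset.sum_mul_sq_le_sq_mul_sq Finset.univ a b

lemma continuousAt_corStat_mulVec {κ : Type*} [Fintype κ] {m : ℕ} {W : Matrix κ ι ℝ}
    {z : (ι → ℝ) × (ι → ℝ)} (hz : corStat m (W *ᵥ z.1) (W *ᵥ z.2) ≠ 0) :
    ContinuousAt (fun z : (ι → ℝ) × (ι → ℝ) => corStat m (W *ᵥ z.1) (W *ᵥ z.2)) z := by
  -- Since `x / 0 = 0`, a nonzero value excludes a vanishing denominator.
  have hdenom : √((W *ᵥ z.1 ⬝ᵥ W *ᵥ z.1) * (W *ᵥ z.2 ⬝ᵥ W *ᵥ z.2)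
      - (W *ᵥ z.1 ⬝ᵥ W *ᵥ z.2) ^ 2) ≠ 0 := by
    intro h
    exact hz (by rw [corStat, h, div_zero, mul_zero])
  unfold corStat mulVec dotProduct at *
  refine continuousAt_const.mul (ContinuousAt.div ?_ ?_ hdenom) <;>
    exact Continuous.continuousAt (by fun_prop)

lemma tendsto_corStat_mulVec_le {δ : Type*} {Ω : δ → Type*} [∀ d, MeasurableSpace (Ω d)]
    {P : ∀ d, Measure (Ω d)} [∀ d, IsProbabilityMeasure (P d)] {L : Filter δ}
    {γ : Measure ((ι → ℝ) × (ι → ℝ))} [IsProbabilityMeasure γ]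
    {X : ∀ d, Ω d → (ι → ℝ) × (ι → ℝ)} (hX : TendstoInDistribution X L (fun z => z) P γ)
    {m : ℕ} (hm : m ≠ 0) {φ : ℝ} {W : Matrix (Fin (m + 1)) ι ℝ}
    (hγ : γ.map (fun z => corStat m (W *ᵥ z.1) (W *ᵥ z.2)) = mixedT φ m) (t : ℝ) :
    Tendsto (fun d => (P d).real {ω | corStat m (W *ᵥ (X d ω).1) (W *ᵥ (X d ω).2) ≤ t})
      L (𝓝 ((mixedT φ m).real (Set.Iic t))) := by
  have hmeas : Measurable fun z : (ι → ℝ) × (ι → ℝ) => corStat m (W *ᵥ z.1) (W *ᵥ z.2) := by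
    unfold corStat mulVec dotProduct
    fun_prop
  have hnull (u : ℝ) : γ {z | corStat m (W *ᵥ z.1) (W *ᵥ z.2) = u} = 0 := by
    rw [← mixedT_singleton φ hm u, ← hγ, Measure.map_apply hmeas (measurableSet_singleton u)]
    rfl
  have hcont : ∀ᵐ z ∂γ, ContinuousAt
      (fun z : (ι → ℝ) × (ι → ℝ) => corStat m (W *ᵥ z.1) (W *ᵥ z.2)) z :=
    measure_mono_null (fun z hz => by_contra fun h => hz (continuousAt_corStat_mulVec h)) (hnull 0)
  rw [← hγ, map_measureReal_apply hmeas measurableSet_Iic]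
  exact tendsto_measureReal_le_of_tendstoInDistribution hX hmeas hcont (hnull t)

end Portmanteau

section LimitMoments

lemma integral_add_mul_sq {α : Type*} [MeasurableSpace α] {μ : Measure α} {f g : α → ℝ}
    (hf : MemLp f 2 μ) (hg : MemLp g 2 μ) (a : ℝ) :
    ∫ z, (f z + a * g z) ^ 2 ∂μ
      = ∫ z, f z ^ 2 ∂μ + 2 * a * ∫ z, f z * g z ∂μ + a ^ 2 * ∫ z, g z ^ 2 ∂μ := by
  have hff : Integrable (fun z => f z ^ 2) μ := hf.integrable_sq
  have hfg : Integrable (fun z => 2 * a * (f z * g z)) μ := (hf.integrable_mul hg).const_mul _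
  have hgg : Integrable (fun z => a ^ 2 * g z ^ 2) μ := hg.integrable_sq.const_mul _
  have h_expand (z : α) :
      (f z + a * g z) ^ 2 = f z ^ 2 + 2 * a * (f z * g z) + a ^ 2 * g z ^ 2 := by ring
  simp only [h_expand]
  rw [integral_add (f := fun z => f z ^ 2 + 2 * a * (f z * g z)) (hff.add hfg) hgg,
    integral_add hff hfg, integral_const_mul, integral_const_mul]

variable {E δ : Type*} [TopologicalSpace E] [MeasurableSpace E] {Ω : δ → Type*}
  [∀ d, MeasurableSpace (Ω d)] {P : ∀ d, Measure (Ω d)} {X : ∀ d, Ω d → E} {L : Filter δ}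
  {γ : Measure E} {f g : E → ℝ}

/-- `f` is centered along `X` and its variances converge to the variance of `f` under the limit
law `γ`; convergence in distribution alone would only give a bound from below. -/
structure TendstoVariance (P : ∀ d, Measure (Ω d)) (X : ∀ d, Ω d → E) (L : Filter δ)
    (γ : Measure E) (f : E → ℝ) : Prop where
  continuous : Continuous f
  memLp_limit : MemLp f 2 γ
  memLp : ∀ d, MemLp (fun ω => f (X d ω)) 2 (P d)
  integral_eq_zero : ∀ d, ∫ ω, f (X d ω) ∂(P d) = 0
  tendsto_variance : Tendsto (fun d => Var[fun ω => f (X d ω); P d]) L (𝓝 Var[f; γ])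

lemma TendstoVariance.tendsto_integral_sq (hf : TendstoVariance P X L γ f) :
    Tendsto (fun d => ∫ ω, f (X d ω) ^ 2 ∂(P d)) L (𝓝 Var[f; γ]) :=
  hf.tendsto_variance.congr fun d =>
    variance_of_integral_eq_zero (hf.memLp d).aemeasurable (hf.integral_eq_zero d)

lemma TendstoVariance.tendsto_integral_mul (hf : TendstoVariance P X L γ f)
    (hg : TendstoVariance P X L γ g) {c : ℝ}
    (hfg : Tendsto (fun d => cov[fun ω => f (X d ω), fun ω => g (X d ω); P d]) L (𝓝 c)) :
    Tendsto (fun d => ∫ ω, f (X d ω) * g (X d ω) ∂(P d)) L (𝓝 c) := by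
  refine hfg.congr fun d => ?_
  simp only [covariance, hf.integral_eq_zero, hg.integral_eq_zero, sub_zero]

variable [BorelSpace E] [HasOuterApproxClosed E] [∀ d, IsProbabilityMeasure (P d)] [L.NeBot]
  [L.IsCountablyGenerated] [IsProbabilityMeasure γ]

lemma integral_le_of_tendstoInDistribution (hX : TendstoInDistribution X L (fun z => z) P γ)
    (hf : Continuous f) (hf_nonneg : 0 ≤ f)
    (hf_int : ∀ d, Integrable (fun ω => f (X d ω)) (P d)) {v : ℝ}
    (hlim : Tendsto (fun d => ∫ ω, f (X d ω) ∂(P d)) L (𝓝 v)) :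
    ∫ z, f z ∂γ ≤ v := by
  have hv : 0 ≤ v := ge_of_tendsto' hlim fun d => integral_nonneg fun ω => hf_nonneg _
  obtain ⟨u, hu⟩ := L.exists_seq_tendsto
  have h_fatou := lintegral_le_liminf_lintegral_of_forall_isOpen_measure_le_liminf_measure
    (μ := γ.map fun z => z) (μs := fun i => (P (u i)).map (X (u i))) hf hf_nonneg
    fun G hG => ProbabilityMeasure.le_liminf_measure_open_of_tendsto (hX.tendsto.comp hu) hG
  have h_lintegral (i : ℕ) : ∫⁻ z, ENNReal.ofReal (f z) ∂((P (u i)).map (X (u i)))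
      = ENNReal.ofReal (∫ ω, f (X (u i) ω) ∂(P (u i))) := by
    rw [lintegral_map' (by fun_prop) (hX.forall_aemeasurable _),
      ofReal_integral_eq_lintegral_ofReal (hf_int _) (.of_forall fun ω => hf_nonneg _)]
  simp only [h_lintegral] at h_fatou
  have h_lim : Tendsto (fun i => ENNReal.ofReal (∫ ω, f (X (u i) ω) ∂(P (u i)))) atTop
      (𝓝 (ENNReal.ofReal v)) := ENNReal.tendsto_ofReal (hlim.comp hu)
  rw [h_lim.liminf_eq, Measure.map_id'] at h_fatou
  rw [integral_eq_lintegral_of_nonneg_ae (.of_forall hf_nonneg) hf.aestronglyMeasurable]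
  exact ENNReal.toReal_le_of_le_ofReal hv h_fatou

lemma TendstoVariance.integral_limit_eq_zero (hX : TendstoInDistribution X L (fun z => z) P γ)
    (hf : TendstoVariance P X L γ f) : ∫ z, f z ∂γ = 0 := by
  have h_le : ∫ z, f z ^ 2 ∂γ ≤ Var[f; γ] := integral_le_of_tendstoInDistribution
    (f := fun z => f z ^ 2) hX (hf.continuous.pow 2) (fun z => sq_nonneg _)
    (fun d => (hf.memLp d).integrable_sq) hf.tendsto_integral_sq
  have h_var : Var[f; γ] = ∫ z, f z ^ 2 ∂γ - (∫ z, f z ∂γ) ^ 2 := variance_eq_sub hf.memLp_limit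
  nlinarith

-- Fatou's bound for `f + a g` is an equality in its `f²` and `g²` terms, so `a = ±1` pins the
-- mixed moment.
lemma TendstoVariance.covariance_limit_eq (hX : TendstoInDistribution X L (fun z => z) P γ)
    (hf : TendstoVariance P X L γ f) (hg : TendstoVariance P X L γ g) {c : ℝ}
    (hfg : Tendsto (fun d => cov[fun ω => f (X d ω), fun ω => g (X d ω); P d]) L (𝓝 c)) :
    cov[f, g; γ] = c := by
  have hf_mean := hf.integral_limit_eq_zero hX
  have hg_mean := hg.integral_limit_eq_zero hX
  have hf_var : Var[f; γ] = ∫ z, f z ^ 2 ∂γ :=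
    variance_of_integral_eq_zero hf.continuous.aemeasurable hf_mean
  have hg_var : Var[g; γ] = ∫ z, g z ^ 2 ∂γ :=
    variance_of_integral_eq_zero hg.continuous.aemeasurable hg_mean
  have h_le (a : ℝ) : 2 * a * ∫ z, f z * g z ∂γ ≤ 2 * a * c := by
    have h_fatou : ∫ z, (f z + a * g z) ^ 2 ∂γ ≤ Var[f; γ] + 2 * a * c + a ^ 2 * Var[g; γ] := by
      refine integral_le_of_tendstoInDistribution (f := fun z => (f z + a * g z) ^ 2) hX
        ((hf.continuous.add (hg.continuous.const_mul a)).pow 2) (fun z => sq_nonneg _)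
        (fun d => ((hf.memLp d).add ((hg.memLp d).const_mul a)).integrable_sq) ?_
      refine ((hf.tendsto_integral_sq.add ((hf.tendsto_integral_mul hg hfg).const_mul (2 * a))).add
        (hg.tendsto_integral_sq.const_mul (a ^ 2))).congr fun d => ?_
      exact (integral_add_mul_sq (hf.memLp d) (hg.memLp d) a).symm
    rw [integral_add_mul_sq hf.memLp_limit hg.memLp_limit, hf_var, hg_var] at h_fatou
    linarith
  have h_cov : cov[f, g; γ] = ∫ z, f z * g z ∂γ := by
    simp only [covariance, hf_mean, hg_mean, sub_zero]
  rw [h_cov]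
  linarith [h_le 1, h_le (-1)]

end LimitMoments

section DoubleCenter

variable {α β : Type*} [MeasurableSpace α] [MeasurableSpace β]

/-- The double centering `k(x, y) - E k(x, V) - E k(U, y) + E k(U, V)` of a kernel, for
independent `U ~ μ` and `V ~ ν`. -/
noncomputable def doubleCenter (μ : Measure α) (ν : Measure β) (k : α → β → ℝ) (x : α) (y : β) :
    ℝ :=
  k x y - ∫ v, k x v ∂ν - ∫ u, k u y ∂μ + ∫ u, ∫ v, k u v ∂ν ∂μ

lemma measurable_doubleCenter (μ : Measure α) (ν : Measure β) [SFinite μ] [SFinite ν]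
    {k : α → β → ℝ} (hk : Measurable (Function.uncurry k)) :
    Measurable (Function.uncurry (doubleCenter μ ν k)) := by
  have h_left : Measurable fun x => ∫ v, k x v ∂ν :=
    (hk.stronglyMeasurable.integral_prod_right (ν := ν)).measurable
  have h_right : Measurable fun y => ∫ u, k u y ∂μ :=
    (hk.stronglyMeasurable.integral_prod_left (μ := μ)).measurable
  exact ((hk.sub (h_left.comp measurable_fst)).sub (h_right.comp measurable_snd)).add_const _

lemma integral_sub_sub_add_const {μ : Measure α} [IsProbabilityMeasure μ] {f g h : α → ℝ}
    (hf : Integrable f μ) (hg : Integrable g μ) (hh : Integrable h μ) (c : ℝ) :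
    ∫ x, (f x - g x - h x + c) ∂μ = ∫ x, f x ∂μ - ∫ x, g x ∂μ - ∫ x, h x ∂μ + c := by
  have hfg : Integrable (fun x => f x - g x) μ := hf.sub hg
  have hfgh : Integrable (fun x => f x - g x - h x) μ := hfg.sub hh
  rw [integral_add hfgh (integrable_const _), integral_sub hfg hh, integral_sub hf hg]
  simp

lemma integral_doubleCenter_left {μ : Measure α} {ν : Measure β} [IsProbabilityMeasure μ]
    [SFinite ν] {k : α → β → ℝ} (hk : Integrable (Function.uncurry k) (μ.prod ν)) :
    ∀ᵐ y ∂ν, ∫ x, doubleCenter μ ν k x y ∂μ = 0 := by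
  have h_left : Integrable (fun x => ∫ v, k x v ∂ν) μ := hk.integral_prod_left
  filter_upwards [hk.prod_left_ae] with y (hy : Integrable (fun x => k x y) μ)
  simp only [doubleCenter]
  rw [integral_sub_sub_add_const hy h_left (integrable_const _)]
  simp

end DoubleCenter

section IndependentPair

variable {Ω α β : Type*} [MeasurableSpace Ω] [MeasurableSpace α] [MeasurableSpace β]
  {P : Measure Ω} [IsProbabilityMeasure P] {x : Ω → α} {y : Ω → β} {k : α → β → ℝ}

lemma integrable_uncurry_of_indepFun (hx : Measurable x) (hy : Measurable y)
    (hxy : IndepFun x y P) (hk : Measurable (Function.uncurry k))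
    (hk_int : Integrable (fun ω => k (x ω) (y ω)) P) :
    Integrable (Function.uncurry k) ((P.map x).prod (P.map y)) := by
  rw [← (indepFun_iff_map_prod_eq_prod_map_map hx.aemeasurable hy.aemeasurable).1 hxy,
    integrable_map_measure hk.aestronglyMeasurable (hx.prodMk hy).aemeasurable]
  exact hk_int

lemma integral_eq_integral_integral_of_indepFun (hx : Measurable x) (hy : Measurable y)
    (hxy : IndepFun x y P) (hk : Measurable (Function.uncurry k))
    (hk_int : Integrable (fun ω => k (x ω) (y ω)) P) :
    ∫ ω, k (x ω) (y ω) ∂P = ∫ u, ∫ v, k u v ∂(P.map y) ∂(P.map x) := by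
  have h_prod := integral_prod _ (integrable_uncurry_of_indepFun hx hy hxy hk hk_int)
  rwa [← (indepFun_iff_map_prod_eq_prod_map_map hx.aemeasurable hy.aemeasurable).1 hxy,
    integral_map (hx.prodMk hy).aemeasurable hk.aestronglyMeasurable] at h_prod

lemma integral_eq_zero_of_indepFun (hx : Measurable x) (hy : Measurable y)
    (hxy : IndepFun x y P) {F : α × β → ℝ} (hF : Measurable F)
    (hF_zero : ∀ᵐ v ∂(P.map y), ∫ u, F (u, v) ∂(P.map x) = 0) :
    ∫ ω, F (x ω, y ω) ∂P = 0 := by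
  rw [← integral_map (f := F) (hx.prodMk hy).aemeasurable hF.aestronglyMeasurable,
    (indepFun_iff_map_prod_eq_prod_map_map hx.aemeasurable hy.aemeasurable).1 hxy]
  by_cases hF_int : Integrable F ((P.map x).prod (P.map y))
  · rw [integral_prod_symm _ hF_int, integral_congr_ae hF_zero, integral_zero]
  · exact integral_undef hF_int

lemma integral_doubleCenter_mul_of_indepFun {γ : Type*} [MeasurableSpace γ] {z : Ω → γ}
    (hx : Measurable x) (hy : Measurable y) (hz : Measurable z)
    (h_indep : IndepFun x (fun ω => (y ω, z ω)) P) (hk : Measurable (Function.uncurry k))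
    (hk_int : Integrable (fun ω => k (x ω) (y ω)) P) {g : γ → ℝ} (hg : Measurable g) :
    ∫ ω, doubleCenter (P.map x) (P.map y) k (x ω) (y ω) * g (z ω) ∂P = 0 := by
  have : IsProbabilityMeasure (P.map x) := Measure.isProbabilityMeasure_map hx.aemeasurable
  have hxy : IndepFun x y P := h_indep.comp measurable_id measurable_fst
  have h_degenerate : ∀ᵐ v ∂(P.map fun ω => (y ω, z ω)),
      ∫ u, doubleCenter (P.map x) (P.map y) k u v.1 ∂(P.map x) = 0 := by
    refine ae_of_ae_map (f := Prod.fst) (p := fun v : β =>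
      ∫ u, doubleCenter (P.map x) (P.map y) k u v ∂(P.map x) = 0) measurable_fst.aemeasurable ?_
    rw [Measure.map_map measurable_fst (hy.prodMk hz)]
    exact integral_doubleCenter_left (integrable_uncurry_of_indepFun hx hy hxy hk hk_int)
  have h_center : Measurable fun w : α × β × γ =>
      doubleCenter (P.map x) (P.map y) k w.1 w.2.1 :=
    (measurable_doubleCenter (P.map x) (P.map y) hk).comp
      (measurable_fst.prodMk (measurable_fst.comp measurable_snd))
  refine integral_eq_zero_of_indepFun hx (hy.prodMk hz) h_indep
    (F := fun w => doubleCenter (P.map x) (P.map y) k w.1 w.2.1 * g w.2.2) ?_ ?_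
  · exact h_center.mul (hg.comp (measurable_snd.comp measurable_snd))
  · filter_upwards [h_degenerate] with v hv
    rw [integral_mul_const, hv, zero_mul]

lemma indepFun_prodMk_right {γ : Type*} [MeasurableSpace γ] {z : Ω → γ} (hx : Measurable x)
    (hy : Measurable y) (hz : Measurable z) (hxy : IndepFun x y P)
    (hxyz : IndepFun (fun ω => (x ω, y ω)) z P) : IndepFun x (fun ω => (y ω, z ω)) P := by
  have hyz : IndepFun y z P := hxyz.comp measurable_snd measurable_id
  rw [indepFun_iff_map_prod_eq_prod_map_map (by fun_prop) (by fun_prop)] at *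
  rw [hyz, ← Measure.prodAssoc_prod, ← hxy, ← hxyz,
    Measure.map_map (by fun_prop) (by fun_prop)]
  rfl

lemma condExp_ae_eq_integral_of_indepFun [StandardBorelSpace β] (hx : Measurable x)
    (hy : Measurable y) (hxy : IndepFun x y P) (hk : Measurable (Function.uncurry k))
    (hk_int : Integrable (fun ω => k (x ω) (y ω)) P) :
    P[fun ω => k (x ω) (y ω) | MeasurableSpace.comap x inferInstance]
      =ᵐ[P] fun ω => ∫ v, k (x ω) v ∂(P.map y) := by
  have : Nonempty β := P.nonempty_of_neZero.map y
  have : IsProbabilityMeasure (P.map y) := Measure.isProbabilityMeasure_map hy.aemeasurable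
  have h_cond : condDistrib y x P =ᵐ[P.map x] Kernel.const α (P.map y) := by
    refine condDistrib_ae_eq_of_measure_eq_compProd x hy.aemeasurable ?_
    rw [Measure.compProd_const]
    exact (indepFun_iff_map_prod_eq_prod_map_map hx.aemeasurable hy.aemeasurable).1 hxy
  refine (condExp_prod_ae_eq_integral_condDistrib (f := Function.uncurry k) hx
    hy.aemeasurable hk.stronglyMeasurable hk_int).trans ?_
  filter_upwards [ae_of_ae_map hx.aemeasurable h_cond] with ω hω
  rw [hω]
  rfl

end IndependentPair

section IndependentSample

variable {Ω ι α β : Type*} [MeasurableSpace Ω] [MeasurableSpace α] [MeasurableSpace β]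
  {P : Measure Ω} {x : ι → Ω → α} {y : ι → Ω → β} {s t a b : ι}

lemma indepFun_triple_of_ne (hx : ∀ r, Measurable (x r)) (hy : ∀ r, Measurable (y r))
    (h_indep : iIndepFun (fun r ω => (x r ω, y r ω)) P) (hst : s ≠ t) (hsa : s ≠ a)
    (hsb : s ≠ b) : IndepFun (x s) (fun ω => (x t ω, y a ω, y b ω)) P := by
  classical
  let S : Finset ι := {s}
  let T : Finset ι := {t, a, b}
  have h_disj : Disjoint S T := by simp [S, T, hst, hsa, hsb]
  have h_fst : Measurable fun z : S → α × β => (z ⟨s, by simp [S]⟩).1 := by fun_prop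
  have h_snd : Measurable fun z : T → α × β =>
      ((z ⟨t, by simp [T]⟩).1, (z ⟨a, by simp [T]⟩).2, (z ⟨b, by simp [T]⟩).2) := by
    fun_prop
  exact (h_indep.indepFun_finset S T h_disj fun r => (hx r).prodMk (hy r)).comp h_fst h_snd

lemma indepFun_triple_of_indepFun [IsProbabilityMeasure P] (hx : ∀ r, Measurable (x r))
    (hy : ∀ r, Measurable (y r)) (h_indep : iIndepFun (fun r ω => (x r ω, y r ω)) P)
    (hst : s ≠ t) (hxy : IndepFun (x s) (y s) P) :
    IndepFun (x s) (fun ω => (x t ω, y s ω, y t ω)) P := by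
  have h := indepFun_prodMk_right (hx s) (hy s) ((hx t).prodMk (hy t)) hxy (h_indep.indepFun hst)
  exact h.comp (ψ := fun w : β × α × β => (w.2.1, w.1, w.2.2)) measurable_id (by fun_prop)

end IndependentSample

section KernelDist

variable {Ω : Type*} [MeasurableSpace Ω] {P : Measure Ω} {n : ℕ} {k l : ℝ → ℝ → ℝ}
  {x y : Fin n → Ω → ℝ} {s t a b : Fin n}

lemma kernelDist_comm (hk_symm : ∀ u v, k u v = k v u) (s t : Fin n) (ω : Ω) :
    kernelDist P k x s t ω = kernelDist P k x t s ω := by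
  simp only [kernelDist, eq_comm (a := s) (b := t), hk_symm (x s _) (x t _)]
  split_ifs <;> ring

variable [IsProbabilityMeasure P]

lemma integral_kernelDist (hs : Measurable (x s)) (ht : Measurable (x t))
    (hk_int : Integrable (fun ω => k (x s ω) (x t ω)) P) :
    ∫ ω, kernelDist P k x s t ω ∂P = 0 := by
  by_cases hst : s = t
  · simp [kernelDist, hst]
  simp only [kernelDist, if_neg hst]
  rw [integral_sub_sub_add_const hk_int integrable_condExp integrable_condExp,
    integral_condExp hs.comap_le, integral_condExp ht.comap_le]
  simp

lemma kernelDist_ae_eq_doubleCenter (hst : s ≠ t) (hs : Measurable (x s)) (ht : Measurable (x t))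
    (h_indep : IndepFun (x s) (x t) P) (hk : Measurable (Function.uncurry k))
    (hk_int : Integrable (fun ω => k (x s ω) (x t ω)) P) :
    kernelDist P k x s t
      =ᵐ[P] fun ω => doubleCenter (P.map (x s)) (P.map (x t)) k (x s ω) (x t ω) := by
  filter_upwards [condExp_ae_eq_integral_of_indepFun hs ht h_indep hk hk_int,
    condExp_ae_eq_integral_of_indepFun (k := fun v u => k u v) ht hs h_indep.symm
      (hk.comp measurable_swap) hk_int] with ω h_left h_right
  rw [kernelDist, if_neg hst, h_left, h_right,
    integral_eq_integral_integral_of_indepFun hs ht h_indep hk hk_int, doubleCenter]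

lemma covariance_kernelDist_of_indepFun (hx : ∀ r, Measurable (x r))
    (hy : ∀ r, Measurable (y r)) (hk : Measurable (Function.uncurry k))
    (hl : Measurable (Function.uncurry l))
    (hk_int : Integrable (fun ω => k (x s ω) (x t ω)) P)
    (hl_int : Integrable (fun ω => l (y a ω) (y b ω)) P) (hst : s ≠ t) (hab : a ≠ b)
    (hy_indep : IndepFun (y a) (y b) P)
    (h_indep : IndepFun (x s) (fun ω => (x t ω, y a ω, y b ω)) P) :
    cov[kernelDist P k x s t, kernelDist P l y a b; P] = 0 := by
  have hx_indep : IndepFun (x s) (x t) P := h_indep.comp measurable_id measurable_fst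
  simp only [covariance, integral_kernelDist (hx s) (hx t) hk_int,
    integral_kernelDist (hy a) (hy b) hl_int, sub_zero]
  refine (integral_congr_ae
    ((kernelDist_ae_eq_doubleCenter hst (hx s) (hx t) hx_indep hk hk_int).mul
      (kernelDist_ae_eq_doubleCenter hab (hy a) (hy b) hy_indep hl hl_int))).trans ?_
  exact integral_doubleCenter_mul_of_indepFun (hx s) (hx t) ((hy a).prodMk (hy b)) h_indep hk
    hk_int (measurable_doubleCenter (P.map (y a)) (P.map (y b)) hl)

end KernelDist

section Statistic

open Matrix

lemma cor_div_sqrt_one_sub_cor_sq {x a b c : ℝ} (hx : x ^ 2 ≤ a * b) (hc : 0 < c) :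
    c * x / √(c * a * (c * b)) / √(1 - (c * x / √(c * a * (c * b))) ^ 2)
      = x / √(a * b - x ^ 2) := by
  have h_scale : √(c * a * (c * b)) = c * √(a * b) := by
    rw [show c * a * (c * b) = c ^ 2 * (a * b) by ring, Real.sqrt_mul (sq_nonneg c),
      Real.sqrt_sq hc.le]
  rw [h_scale, mul_div_mul_left _ _ hc.ne']
  rcases ((sq_nonneg x).trans hx).eq_or_lt with hab | hab
  · have hx_zero : x = 0 := by nlinarith
    simp [hx_zero]
  · have h_one_sub : 1 - (x / √(a * b)) ^ 2 = (a * b - x ^ 2) / (a * b) := by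
      rw [div_pow, Real.sq_sqrt hab.le, sub_div, div_self hab.ne']
    rw [h_one_sub, Real.sqrt_div (sub_nonneg.2 hx), div_div_div_cancel_right₀]
    exact (Real.sqrt_pos.2 hab).ne'

variable {Ω : Type*} [MeasurableSpace Ω] {P : Measure Ω} {n p q : ℕ} {k l : ℝ → ℝ → ℝ}

lemma kernelMat_comm (hk_symm : ∀ u v, k u v = k v u) (X : Fin n → Ω → Fin p → ℝ) (i : Fin p)
    (ω : Ω) (s t : Fin n) : kernelMat P k X i ω s t = kernelMat P k X i ω t s :=
  kernelDist_comm (x := fun r ω => X r ω i) hk_symm s t ω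

lemma kernelMat_eq_symMat (hk_symm : ∀ u v, k u v = k v u) (X : Fin n → Ω → Fin p → ℝ)
    (i : Fin p) (ω : Ω) :
    kernelMat P k X i ω = symMat fun e => kernelMat P k X i ω e.1.1 e.1.2 :=
  eq_symMat (kernelMat_comm hk_symm X i ω) fun _ => if_pos rfl

lemma normSum_eq_smul_sum (X : Fin n → Ω → Fin p → ℝ) (ω : Ω) : normSum P k X ω
    = (1 / √(p : ℝ)) • ∑ i, fun e : Pairs n => kernelMat P k X i ω e.1.1 e.1.2 := by
  ext e
  simp [normSum, Finset.sum_apply]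

variable {m : ℕ} {W : Matrix (Fin m) (Pairs n) ℝ} {r : ℝ}

lemma uCov_eq_mul_dotProduct
    (hW : ∀ c d : Pairs n → ℝ, uInner (uCenter (symMat c)) (uCenter (symMat d))
      = r * ((W *ᵥ c) ⬝ᵥ (W *ᵥ d)))
    (hk_symm : ∀ u v, k u v = k v u) (hl_symm : ∀ u v, l u v = l v u)
    (X : Fin n → Ω → Fin p → ℝ) (Y : Fin n → Ω → Fin q → ℝ) (ω : Ω) :
    uCov P k l X Y ω = r * ((W *ᵥ normSum P k X ω) ⬝ᵥ (W *ᵥ normSum P l Y ω)) := by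
  have h_inner (i : Fin p) (j : Fin q) :
      uInner (uCenter (kernelMat P k X i ω)) (uCenter (kernelMat P l Y j ω))
        = r * ((W *ᵥ fun e => kernelMat P k X i ω e.1.1 e.1.2) ⬝ᵥ
          (W *ᵥ fun e => kernelMat P l Y j ω e.1.1 e.1.2)) := by
    rw [← hW, ← kernelMat_eq_symMat hk_symm, ← kernelMat_eq_symMat hl_symm]
  simp only [uCov, h_inner, ← Finset.mul_sum, Real.sqrt_mul (Nat.cast_nonneg p),
    normSum_eq_smul_sum, mulVec_smul, mulVec_sum, smul_dotProduct, dotProduct_smul,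
    sum_dotProduct, smul_eq_mul]
  simp only [dotProduct_sum]
  ring

lemma studentized_eq_corStat (hm : dof n = m) (hm_pos : 0 < m)
    (hW : ∀ c d : Pairs n → ℝ, uInner (uCenter (symMat c)) (uCenter (symMat d))
      = (m : ℝ)⁻¹ * ((W *ᵥ c) ⬝ᵥ (W *ᵥ d)))
    (hk_symm : ∀ u v, k u v = k v u) (hl_symm : ∀ u v, l u v = l v u)
    (X : Fin n → Ω → Fin p → ℝ) (Y : Fin n → Ω → Fin q → ℝ) (ω : Ω) :
    studentized P k l X Y ω
      = corStat (m - 1) (W *ᵥ normSum P k X ω) (W *ᵥ normSum P l Y ω) := by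
  rw [studentized, uCor, uCov_eq_mul_dotProduct hW hk_symm hl_symm,
    uCov_eq_mul_dotProduct hW hk_symm hk_symm, uCov_eq_mul_dotProduct hW hl_symm hl_symm,
    cor_div_sqrt_one_sub_cor_sq (dotProduct_sq_le _ _) (by positivity), corStat, hm,
    Nat.cast_pred hm_pos]

end Statistic

section KernelSample

variable {Ω : Type*} [MeasurableSpace Ω] {n p q : ℕ}

/-- A sample `X` of random vectors in `ℝ^p` together with a measurable symmetric kernel `k` whose
double centered distances `k_st(i)` are defined and square integrable. -/
structure KernelSample (P : Measure Ω) (k : ℝ → ℝ → ℝ) (X : Fin n → Ω → Fin p → ℝ) : Prop where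
  measurable_kernel : Measurable (Function.uncurry k)
  kernel_comm : ∀ u v, k u v = k v u
  measurable : ∀ s, Measurable (X s)
  integrable : ∀ s t, s ≠ t → ∀ i, Integrable (fun ω => k (X s ω i) (X t ω i)) P
  memLp : ∀ s t, s ≠ t → ∀ i, MemLp (fun ω => kernelMat P k X i ω s t) 2 P

variable {P : Measure Ω} {k l : ℝ → ℝ → ℝ} {X : Fin n → Ω → Fin p → ℝ}
  {Y : Fin n → Ω → Fin q → ℝ}

lemma KernelSample.measurable_coord (hX : KernelSample P k X) (i : Fin p) (s : Fin n) :
    Measurable fun ω => X s ω i :=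
  (measurable_pi_apply i).comp (hX.measurable s)

lemma KernelSample.memLp_normSum (hX : KernelSample P k X) (e : Pairs n) :
    MemLp (fun ω => normSum P k X ω e) 2 P :=
  (memLp_finsetSum _ fun i _ => hX.memLp _ _ e.2.ne i).const_mul _

variable [IsProbabilityMeasure P]

lemma KernelSample.integral_normSum (hX : KernelSample P k X) (e : Pairs n) :
    ∫ ω, normSum P k X ω e ∂P = 0 := by
  simp only [normSum]
  rw [integral_const_mul,
    integral_finsetSum _ fun i _ => (hX.memLp _ _ e.2.ne i).integrable one_le_two]
  refine mul_eq_zero_of_right _ (Finset.sum_eq_zero fun i _ => ?_)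
  exact integral_kernelDist (x := fun s ω => X s ω i) (hX.measurable_coord i _)
    (hX.measurable_coord i _) (hX.integrable _ _ e.2.ne i)

lemma KernelSample.covariance_normSum (hX : KernelSample P k X) (hY : KernelSample P l Y)
    (e e' : Pairs n) :
    cov[fun ω => normSum P k X ω e, fun ω => normSum P l Y ω e'; P]
      = 1 / √((p : ℝ) * q) * ∑ i, ∑ j, cov[fun ω => kernelMat P k X i ω e.1.1 e.1.2,
          fun ω => kernelMat P l Y j ω e'.1.1 e'.1.2; P] := by
  simp only [normSum]
  rw [covariance_const_mul_left, covariance_const_mul_right,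
    covariance_fun_sum_fun_sum (fun i => hX.memLp _ _ e.2.ne i) fun j => hY.memLp _ _ e'.2.ne j,
    Real.sqrt_mul (Nat.cast_nonneg p), ← mul_assoc, one_div_mul_one_div]

lemma KernelSample.variance_normSum (hX : KernelSample P k X) (e : Pairs n) :
    Var[fun ω => normSum P k X ω e; P]
      = 1 / (p : ℝ) * ∑ i, ∑ j, cov[fun ω => kernelMat P k X i ω e.1.1 e.1.2,
          fun ω => kernelMat P k X j ω e.1.1 e.1.2; P] := by
  rw [← covariance_self (hX.memLp_normSum e).aemeasurable, hX.covariance_normSum hX,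
    Real.sqrt_mul_self (Nat.cast_nonneg p)]

lemma KernelSample.covariance_kernelMat_of_ne (hX : KernelSample P k X) (hY : KernelSample P l Y)
    (h_indep : iIndepFun (fun s ω => (X s ω, Y s ω)) P) {s t a b : Fin n} (hst : s ≠ t)
    (hab : a ≠ b) (hsa : s ≠ a) (hsb : s ≠ b) (i : Fin p) (j : Fin q) :
    cov[fun ω => kernelMat P k X i ω s t, fun ω => kernelMat P l Y j ω a b; P] = 0 := by
  have h_coord : iIndepFun (fun r ω => (X r ω i, Y r ω j)) P :=
    h_indep.comp (fun _ z => (z.1 i, z.2 j)) fun _ => by fun_prop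
  exact covariance_kernelDist_of_indepFun (hX.measurable_coord i) (hY.measurable_coord j)
    hX.measurable_kernel hY.measurable_kernel (hX.integrable _ _ hst i)
    (hY.integrable _ _ hab j) hst hab ((h_coord.indepFun hab).comp measurable_snd measurable_snd)
    (indepFun_triple_of_ne (hX.measurable_coord i) (hY.measurable_coord j) h_coord hst hsa hsb)

lemma KernelSample.covariance_kernelMat_of_indepFun (hX : KernelSample P k X)
    (hY : KernelSample P l Y) (h_indep : iIndepFun (fun s ω => (X s ω, Y s ω)) P)
    {s t : Fin n} (hst : s ≠ t) (hXY : IndepFun (X s) (Y s) P) (i : Fin p) (j : Fin q) :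
    cov[fun ω => kernelMat P k X i ω s t, fun ω => kernelMat P l Y j ω s t; P] = 0 := by
  have h_coord : iIndepFun (fun r ω => (X r ω i, Y r ω j)) P :=
    h_indep.comp (fun _ z => (z.1 i, z.2 j)) fun _ => by fun_prop
  exact covariance_kernelDist_of_indepFun (hX.measurable_coord i) (hY.measurable_coord j)
    hX.measurable_kernel hY.measurable_kernel (hX.integrable _ _ hst i)
    (hY.integrable _ _ hst j) hst hst ((h_coord.indepFun hst).comp measurable_snd measurable_snd)
    (indepFun_triple_of_indepFun (hX.measurable_coord i) (hY.measurable_coord j) h_coord hst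
      (hXY.comp (measurable_pi_apply i) (measurable_pi_apply j)))

lemma KernelSample.covariance_kernelMat_of_pair_ne (hX : KernelSample P k X)
    (hY : KernelSample P l Y) (h_indep : iIndepFun (fun s ω => (X s ω, Y s ω)) P)
    {e e' : Pairs n} (hee' : e ≠ e') (i : Fin p) (j : Fin q) :
    cov[fun ω => kernelMat P k X i ω e.1.1 e.1.2,
      fun ω => kernelMat P l Y j ω e'.1.1 e'.1.2; P] = 0 := by
  by_cases h_fst : e.1.1 ≠ e'.1.1 ∧ e.1.1 ≠ e'.1.2
  · exact hX.covariance_kernelMat_of_ne hY h_indep e.2.ne e'.2.ne h_fst.1 h_fst.2 i j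
  · have h_snd : e.1.2 ≠ e'.1.1 ∧ e.1.2 ≠ e'.1.2 := by
      obtain ⟨⟨s, t⟩, hst⟩ := e
      obtain ⟨⟨a, b⟩, hab⟩ := e'
      simp only [ne_eq, Subtype.mk.injEq, Prod.mk.injEq] at hee' h_fst hst hab ⊢
      omega
    simp only [kernelMat_comm hX.kernel_comm X i _ e.1.1 e.1.2]
    exact hX.covariance_kernelMat_of_ne hY h_indep e.2.ne' e'.2.ne h_snd.1 h_snd.2 i j

lemma KernelSample.covariance_normSum_of_ne (hX : KernelSample P k X) (hY : KernelSample P l Y)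
    (h_indep : iIndepFun (fun s ω => (X s ω, Y s ω)) P) {e e' : Pairs n} (hee' : e ≠ e') :
    cov[fun ω => normSum P k X ω e, fun ω => normSum P l Y ω e'; P] = 0 := by
  simp [hX.covariance_normSum hY, hX.covariance_kernelMat_of_pair_ne hY h_indep hee']

end KernelSample

section Limit

variable {n : ℕ}

lemma TendstoVariance.of_normSum {E δ : Type*} [TopologicalSpace E] [MeasurableSpace E]
    {Ω : δ → Type*} [∀ d, MeasurableSpace (Ω d)] {P : ∀ d, Measure (Ω d)}
    [∀ d, IsProbabilityMeasure (P d)] {L : Filter δ} {γ : Measure E} {f : E → ℝ}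
    {Z : ∀ d, Ω d → E} {dim : δ → ℕ} {k : ℝ → ℝ → ℝ}
    {X : ∀ d, Fin n → Ω d → Fin (dim d) → ℝ} (hX : ∀ d, KernelSample (P d) k (X d))
    {e : Pairs n} (hZ : ∀ d ω, f (Z d ω) = normSum (P d) k (X d) ω e) (hf : Continuous f)
    (hf_memLp : MemLp f 2 γ)
    (hlim : Tendsto (fun d => 1 / (dim d : ℝ) * ∑ i, ∑ j,
        cov[fun ω => kernelMat (P d) k (X d) i ω e.1.1 e.1.2,
          fun ω => kernelMat (P d) k (X d) j ω e.1.1 e.1.2; P d]) L (𝓝 Var[f; γ])) :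
    TendstoVariance P Z L γ f where
  continuous := hf
  memLp_limit := hf_memLp
  memLp d := by simpa only [hZ] using (hX d).memLp_normSum e
  integral_eq_zero d := by simpa only [hZ] using (hX d).integral_normSum e
  tendsto_variance := by simpa only [hZ, (hX _).variance_normSum] using hlim

variable {Ω : ℕ × ℕ → Type*} [∀ d, MeasurableSpace (Ω d)]
  {P : ∀ d, Measure (Ω d)} [∀ d, IsProbabilityMeasure (P d)]
  {X : ∀ d : ℕ × ℕ, Fin n → Ω d → Fin d.1 → ℝ} {Y : ∀ d : ℕ × ℕ, Fin n → Ω d → Fin d.2 → ℝ}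
  {k l : ℝ → ℝ → ℝ} {σx σy σxy φ : ℝ}

lemma KernelCLT.exists_gaussian_limit (hCLT : KernelCLT P k l X Y σx σy σxy)
    (hX : ∀ d, KernelSample (P d) k (X d)) (hY : ∀ d, KernelSample (P d) l (Y d))
    (h_indep : ∀ d, iIndepFun (fun s ω => (X d s ω, Y d s ω)) (P d)) :
    ∃ (γ : Measure ((Pairs n → ℝ) × (Pairs n → ℝ))) (_ : IsGaussian γ),
      TendstoInDistribution
        (fun d ω => (normSum (P d) k (X d) ω, normSum (P d) l (Y d) ω))
        atTop (fun z => z) P γ ∧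
      (∀ e, ∫ z, z.1 e ∂γ = 0) ∧ (∀ e, ∫ z, z.2 e ∂γ = 0) ∧
      (∀ e e', cov[fun z => z.1 e, fun z => z.1 e'; γ] = if e = e' then σx ^ 2 else 0) ∧
      (∀ e e', cov[fun z => z.2 e, fun z => z.2 e'; γ] = if e = e' then σy ^ 2 else 0) ∧
      (∀ e e', cov[fun z => z.1 e, fun z => z.2 e'; γ] = if e = e' then σxy ^ 2 else 0) := by
  obtain ⟨γ, hγ, hT, hvar⟩ := hCLT.tendsto_gaussian
  have h_id : HasGaussianLaw (fun z : (Pairs n → ℝ) × (Pairs n → ℝ) => z) γ :=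
    IsGaussian.hasGaussianLaw_id
  let Z (d) (ω : Ω d) := (normSum (P d) k (X d) ω, normSum (P d) l (Y d) ω)
  have h_fst (e : Pairs n) : TendstoVariance P Z atTop γ fun z => z.1 e :=
    .of_normSum hX (fun _ _ => rfl) (by fun_prop) (h_id.fst.eval e).memLp_two
      ((hvar e).1 ▸ hCLT.tendsto_x e.1.1 e.1.2 e.2)
  have h_snd (e : Pairs n) : TendstoVariance P Z atTop γ fun z => z.2 e :=
    .of_normSum hY (fun _ _ => rfl) (by fun_prop) (h_id.snd.eval e).memLp_two
      ((hvar e).2.1 ▸ hCLT.tendsto_y e.1.1 e.1.2 e.2)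
  have h_indep_XX (d) : iIndepFun (fun s ω => (X d s ω, X d s ω)) (P d) :=
    (h_indep d).comp (fun _ z => (z.1, z.1)) fun _ => by fun_prop
  have h_indep_YY (d) : iIndepFun (fun s ω => (Y d s ω, Y d s ω)) (P d) :=
    (h_indep d).comp (fun _ z => (z.2, z.2)) fun _ => by fun_prop
  refine ⟨γ, hγ, hT, fun e => (h_fst e).integral_limit_eq_zero hT,
    fun e => (h_snd e).integral_limit_eq_zero hT, fun e e' => ?_, fun e e' => ?_, fun e e' => ?_⟩
  all_goals split_ifs with h
  · rw [← h, covariance_self (h_fst e).continuous.aemeasurable, (hvar e).1]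
  · exact (h_fst e).covariance_limit_eq hT (h_fst e') <| tendsto_const_nhds.congr fun d =>
      ((hX d).covariance_normSum_of_ne (hX d) (h_indep_XX d) h).symm
  · rw [← h, covariance_self (h_snd e).continuous.aemeasurable, (hvar e).2.1]
  · exact (h_snd e).covariance_limit_eq hT (h_snd e') <| tendsto_const_nhds.congr fun d =>
      ((hY d).covariance_normSum_of_ne (hY d) (h_indep_YY d) h).symm
  · rw [← h, (hvar e).2.2]
  · exact (h_fst e).covariance_limit_eq hT (h_snd e') <| tendsto_const_nhds.congr fun d =>
      ((hX d).covariance_normSum_of_ne (hY d) (h_indep d) h).symm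

lemma KernelCLT.sq_eq_zero_of_indepFun (hn : 2 ≤ n) (hCLT : KernelCLT P k l X Y σx σy σxy)
    (hX : ∀ d, KernelSample (P d) k (X d)) (hY : ∀ d, KernelSample (P d) l (Y d))
    (h_indep : ∀ d, iIndepFun (fun s ω => (X d s ω, Y d s ω)) (P d))
    (hXY : ∀ d s, IndepFun (X d s) (Y d s) (P d)) : σxy ^ 2 = 0 := by
  obtain ⟨s, t, hst⟩ : ∃ s t : Fin n, s < t :=
    ⟨⟨0, by omega⟩, ⟨1, by omega⟩, Fin.mk_lt_mk.2 one_pos⟩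
  refine tendsto_nhds_unique (hCLT.tendsto_xy s t hst) (tendsto_const_nhds.congr fun d => ?_)
  simp [(hX d).covariance_kernelMat_of_indepFun (hY d) (h_indep d) hst.ne (hXY d s)]

theorem KernelCLT.tendsto_studentized_le (hn : 4 ≤ n) (hCLT : KernelCLT P k l X Y σx σy σxy)
    (hX : ∀ d, KernelSample (P d) k (X d)) (hY : ∀ d, KernelSample (P d) l (Y d))
    (h_indep : ∀ d, iIndepFun (fun s ω => (X d s ω, Y d s ω)) (P d))
    (hσx : 0 < σx) (hσy : 0 < σy) (hφ : σxy ^ 2 = σx * σy * φ) (hφ_nonneg : 0 ≤ φ)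
    (hφ_lt : φ < 1) (t : ℝ) :
    Tendsto (fun d => (P d).real {ω | studentized (P d) k l (X d) (Y d) ω ≤ t})
      atTop (𝓝 ((mixedT φ (dof n - 1)).real (Set.Iic t))) := by
  have h_dof := two_le_dof hn
  obtain ⟨m, hm⟩ : ∃ m, dof n = m + 1 := ⟨dof n - 1, by omega⟩
  obtain ⟨W, hW, hW_inner⟩ := exists_uInner_uCenter_symMat (n := n) (by omega)
  obtain ⟨γ, hγ, hT, hX_mean, hY_mean, hX_cov, hY_cov, hXY_cov⟩ :=
    hCLT.exists_gaussian_limit hX hY h_indep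
  have h_corStat (d) (ω) := studentized_eq_corStat (P := P d) rfl (by omega) hW_inner
    (hX d).kernel_comm (hY d).kernel_comm (X d) (Y d) ω
  simp only [h_corStat]
  generalize dof n = v at *
  subst hm
  refine tendsto_corStat_mulVec_le hT (by omega) ?_ t
  exact map_corStat_mulVec_eq_mixedT hφ_nonneg hφ_lt hW hσx hσy IsGaussian.hasGaussianLaw_id
    hX_mean hY_mean hX_cov hY_cov fun e e' => by rw [hXY_cov, hφ]

end Limit

end HDIndep

theorem proposition3_general {n : ℕ} (hn : 4 ≤ n)
    {Ω : ℕ × ℕ → Type*} [∀ d, MeasurableSpace (Ω d)]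
    (P : ∀ d, Measure (Ω d)) [∀ d, IsProbabilityMeasure (P d)]
    (X : ∀ d : ℕ × ℕ, Fin n → Ω d → Fin d.1 → ℝ)
    (Y : ∀ d : ℕ × ℕ, Fin n → Ω d → Fin d.2 → ℝ)
    (hX : ∀ d s, Measurable (X d s)) (hY : ∀ d s, Measurable (Y d s))
    (h_indep : ∀ d, iIndepFun (fun s ω => (X d s ω, Y d s ω)) (P d))
    (k l : ℝ → ℝ → ℝ)
    (hk : Measurable (Function.uncurry k)) (hl : Measurable (Function.uncurry l))
    (hk_symm : ∀ x y, k x y = k y x) (hl_symm : ∀ x y, l x y = l y x)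
    (hkX : KernelMoments P k X) (hlY : KernelMoments P l Y)
    (σx σy σxy φ : ℝ) (hσx : 0 < σx) (hσy : 0 < σy)
    (hCLT : KernelCLT P k l X Y σx σy σxy)
    (hφ : φ = σxy ^ 2 / √(σx ^ 2 * σy ^ 2)) (hφ_lt : φ < 1) :
    ((∀ d s, IndepFun (X d s) (Y d s) (P d)) →
      ∀ t : ℝ, Tendsto
        (fun d : ℕ × ℕ => (P d).real {ω | studentized (P d) k l (X d) (Y d) ω ≤ t})
        atTop (𝓝 ((studentT (dof n - 1)).real (Set.Iic t)))) ∧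
    (∀ t : ℝ, Tendsto
      (fun d : ℕ × ℕ => (P d).real {ω | studentized (P d) k l (X d) (Y d) ω ≤ t})
      atTop (𝓝 (∫ w, (noncentralT (dof n - 1) w).real (Set.Iic t) ∂(lawW φ (dof n))))) := by
  have hX_sample (d) : KernelSample (P d) k (X d) := ⟨hk, hk_symm, hX d,
    fun s t h i => (hkX d s t h i).1, fun s t h i => (hkX d s t h i).2⟩
  have hY_sample (d) : KernelSample (P d) l (Y d) := ⟨hl, hl_symm, hY d,
    fun s t h i => (hlY d s t h i).1, fun s t h i => (hlY d s t h i).2⟩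
  have hφ_eq : φ = σxy ^ 2 / (σx * σy) := by
    rw [hφ, ← mul_pow, Real.sqrt_sq (by positivity)]
  have hφ_nonneg : 0 ≤ φ := by rw [hφ_eq]; positivity
  have h_cov : σxy ^ 2 = σx * σy * φ := by rw [hφ_eq]; field_simp
  have h_lim := hCLT.tendsto_studentized_le hn hX_sample hY_sample h_indep hσx hσy h_cov
    hφ_nonneg hφ_lt
  refine ⟨fun hXY t => ?_, fun t => ?_⟩
  · have hφ_zero : φ = 0 := by
      rw [hφ_eq, hCLT.sq_eq_zero_of_indepFun (by omega) hX_sample hY_sample h_indep hXY, zero_div]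
    simpa only [hφ_zero, mixedT_zero] using h_lim t
  · have h_dof : dof n - 1 + 1 = dof n := by have := two_le_dof hn; omega
    simpa only [mixedT_real_apply φ _ measurableSet_Iic, h_dof] using h_lim t

theorem proposition3 {n : ℕ} (hn : 4 ≤ n)
    {Ω : ℕ × ℕ → Type*} [∀ d, MeasurableSpace (Ω d)]
    (P : ∀ d, Measure (Ω d)) [∀ d, IsProbabilityMeasure (P d)]
    (X : ∀ d : ℕ × ℕ, Fin n → Ω d → Fin d.1 → ℝ)
    (Y : ∀ d : ℕ × ℕ, Fin n → Ω d → Fin d.2 → ℝ)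
    (hXY : ∀ d, IsIIDSample (P d) (X d) (Y d))
    (k l : ℝ → ℝ → ℝ)
    (hk : Measurable (Function.uncurry k)) (hl : Measurable (Function.uncurry l))
    (hk_symm : ∀ x y, k x y = k y x) (hl_symm : ∀ x y, l x y = l y x)
    (hX_bdd : BoundedMoments P X) (hY_bdd : BoundedMoments P Y)
    (hkX : KernelMoments P k X) (hlY : KernelMoments P l Y)
    (σx σy σxy φ : ℝ) (hσx : 0 < σx) (hσy : 0 < σy)
    (hCLT : KernelCLT P k l X Y σx σy σxy)
    (hφ : φ = σxy ^ 2 / √(σx ^ 2 * σy ^ 2)) (hφ_lt : φ < 1) :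
    ((∀ d s, IndepFun (X d s) (Y d s) (P d)) →
      ∀ t : ℝ, Tendsto
        (fun d : ℕ × ℕ => (P d).real {ω | studentized (P d) k l (X d) (Y d) ω ≤ t})
        atTop (𝓝 ((studentT (dof n - 1)).real (Set.Iic t)))) ∧
    (∀ t : ℝ, Tendsto
      (fun d : ℕ × ℕ => (P d).real {ω | studentized (P d) k l (X d) (Y d) ω ≤ t})
      atTop (𝓝 (∫ w, (noncentralT (dof n - 1) w).real (Set.Iic t) ∂(lawW φ (dof n))))) :=
  proposition3_general hn P X Y (fun d => (hXY d).measurable_X) (fun d => (hXY d).measurable_Y)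
    (fun d => (hXY d).indep) k l hk hl hk_symm hl_symm hkX hlY σx σy σxy φ hσx hσy hCLT hφ hφ_lt
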